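/- Let $b>0$ and let $f:\mathbb R\to[0,\infty)$ be a probability density which is symmetric ($f(-x)=f(x)$) and unimodal (nonincreasing on $[0,\infty)$), with bounded support $[-b,b]$: $f(x)>0$ for every $x\in[-b,b]$ and $f(x)=0$ for $x\notin[-b,b]$. Suppose that $f$ is continuously differentiable on $(0,b)$ with $f'<0$ there. Let $F$ be the distribution function of $f$, and let $\alpha\in(0,1)$ and $\mu\in\mathbb R$ satisfy $1-\alpha=2(1-F(\mu/2))$ $(=2F(-\mu/2))$. Let $P$ and $Q$ be the laws with distribution functions $F(\cdot+\mu/2)$ and $F(\cdot-\mu/2)$, and let $P_0$ be the law with density $\frac{1}{1-\alpha}\min\{f(x+\mu/2),f(x-\mu/2)\}$ (the common core of $P$ and $Q$). Write $d_{\mathrm{TV}}(P,Q)=\sup_B|P(B)-Q(B)|$ ($B$ Borel), let $\mathcal W_2$ be the quadratic Wasserstein distance on $\mathbb R$, and for $\beta<1$ let $\mathcal R_\beta(P)$ be the set of probability measures $R\ll P$ with $\frac{dR}{dP}\le\frac1{1-\beta}$ $P$-a.s. Then: 1. $d_{\mathrm{TV}}(P,Q)=\alpha$. 2. Let $K>0$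 and $\alpha_n=\alpha+K/\sqrt n$. If $\tilde P_n\in\mathcal R_{\alpha_n}(P)$ and $\tilde Q_n\in\mathcal R_{\alpha_n}(Q)$ for all sufficiently large $n$, then $$\mathcal W_2(\tilde P_n,\tilde Q_n)=O(n^{-1/2})\quad\Longrightarrow\quad \mathcal W_2(\tilde P_n,P_0)=O(n^{-2/5}).$$ 3. Consequently the pair $(P,Q)$ satisfies, with $\rho=4/5$, the condition: for every $K>0$ and all $\tilde P_n\in\mathcal R_{\alpha_n}(P)$, $\tilde Q_n\in\mathcal R_{\alpha_n}(Q)$ ($n$ large), where $\alpha_n=d_{\mathrm{TV}}(P,Q)+K/\sqrt n$, $\mathcal W_2(\tilde P_n,\tilde Q_n)=O(n^{-1/2})$ implies $\mathcal W_2(\tilde P_n,P_0)=O(n^{-\rho/2})$. -/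

import Mathlib

open MeasureTheory ProbabilityTheory Filter
open scoped ENNReal NNReal

noncomputable section

/-- Total variation distance: supremum over Borel sets `B` of `|P(B) - Q(B)|`. -/
def tvDist (P Q : Measure ℝ) : ℝ :=
  ⨆ B : {B : Set ℝ // MeasurableSet B}, |P.real B - Q.real B|

/-- The set of `α`-trimmed versions of `P`: the probabilities `R ≪ P` with
`dR/dP ≤ 1 / (1 - α)`, `P`-almost surely (meaningful for `α < 1`). -/
def trimmings (α : ℝ) (P : Measure ℝ) : Set (Measure ℝ) :=
  {R | IsProbabilityMeasure R ∧ R ≪ P ∧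
    ∀ᵐ x ∂P, R.rnDeriv P x ≤ ENNReal.ofReal (1 / (1 - α))}

/-- Measures on the plane with marginals `P` and `Q`. -/
def couplings (P Q : Measure ℝ) : Set (Measure (ℝ × ℝ)) :=
  {π | π.map Prod.fst = P ∧ π.map Prod.snd = Q}

/-- Quadratic Wasserstein distance: the square root of the minimal quadratic transportation
cost, with values in `[0, ∞]`. -/
def W2 (P Q : Measure ℝ) : ℝ≥0∞ :=
  (⨅ π ∈ couplings P Q, ∫⁻ z, ENNReal.ofReal ((z.1 - z.2) ^ 2) ∂π) ^ (1 / 2 : ℝ)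

/-- `w n = O(n ^ (-r))` as `n → ∞`, for a sequence in `[0, ∞]`; in particular `w n` is
eventually finite. -/
def IsBigORate (w : ℕ → ℝ≥0∞) (r : ℝ) : Prop :=
  ∃ C : ℝ≥0, ∀ᶠ n : ℕ in atTop, w n ≤ C * ENNReal.ofReal ((n : ℝ) ^ (-r))

/-- The measure on the line with Lebesgue density `f`. -/
def lawOf (f : ℝ → ℝ) : Measure ℝ :=
  volume.withDensity fun x => ENNReal.ofReal (f x)

/-- `f` is a symmetric, unimodal probability density with support `[-b, b]`, strictly positive
on the support, continuously differentiable on `(0, b)` and with `f' < 0` there. -/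
structure IsSymmUnimodalDensity (f : ℝ → ℝ) (b : ℝ) : Prop where
  b_pos : 0 < b
  symm : ∀ x, f (-x) = f x
  unimodal : AntitoneOn f (Set.Ici 0)
  pos : ∀ x ∈ Set.Icc (-b) b, 0 < f x
  zero_off : ∀ x ∉ Set.Icc (-b) b, f x = 0
  integral_eq_one : ∫ x, f x = 1
  contDiffOn : ContDiffOn ℝ 1 f (Set.Ioo 0 b)
  deriv_neg : ∀ x ∈ Set.Ioo 0 b, deriv f x < 0

/-- The common core of the laws with densities `f₁`, `f₂`: the law with density
`min f₁ f₂ / (1 - α)`, where `α` is the total variation distance of the two laws. -/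
def commonCore (α : ℝ) (f₁ f₂ : ℝ → ℝ) : Measure ℝ :=
  lawOf fun x => min (f₁ x) (f₂ x) / (1 - α)

/-- The rate condition with exponent `ρ ∈ (0, 1]` for the pair `P`, `Q` with common core `P₀`,
for trimming levels `d_TV(P, Q) + K / √n`, `K > 0`. A trimming level is required to be less
than `1` only for large `n`, so the sequences are constrained only for large `n`. -/
def RateCondition (P Q P₀ : Measure ℝ) (ρ : ℝ) : Prop :=
  0 < ρ ∧ ρ ≤ 1 ∧ ∀ K : ℝ, 0 < K → ∀ Pt Qt : ℕ → Measure ℝ,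
    (∀ᶠ n : ℕ in atTop, Pt n ∈ trimmings (tvDist P Q + K / Real.sqrt n) P ∧
      Qt n ∈ trimmings (tvDist P Q + K / Real.sqrt n) Q) →
    IsBigORate (fun n => W2 (Pt n) (Qt n)) (1 / 2) →
    IsBigORate (fun n => W2 (Pt n) P₀) (ρ / 2)

end

/-! Write `h = μ/2` and `a = b - h`; the level condition forces `0 < h < b`. By unimodality the
smaller of the two shifted densities is that of `P` on `[0, ∞)` and that of `Q` on `(-∞, 0]`. Hence,
with `κ` of order `n^(-1/2)`, a trimming `R` of `P` is at most `(1 + κ) P₀` on `[0, ∞)`, and a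
trimming `S` of `Q` is at most `(1 + κ) P₀` on `(-∞, 0]`.

On `[0, a]` the difference `D = cdf R - cdf P₀` is therefore decreasing and nonnegative up to errors
`κ`. Near `0` the densities of `P` and `Q` differ by `O(|x|)`, because `f` is Lipschitz near `h`, so
`S` exceeds `P₀` on `(0, t]` by `O(κ + t²)` and `|D t| ≤ |cdf R t - cdf S t| + O(κ + t²)`. Bounded
densities give `∫ (cdf R - cdf S)² = O(W2(R, S)²) = O(1/n)`, so `∫ D²` over `[0, s]` is `O(1/n +
s⁵)`. Almost monotonicity carries this to all of `[0, a]` at the price of a factor `1/s`; the choice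
`s = n^(-1/5)` balances the terms at `n^(-4/5)`. The left half-line is the mirror image with `S` in
place of `R`.

Finally `f b > 0` bounds the density of `P₀` below on `[-a, a]`, so the quantile coupling turns `∫
D²` into a bound for `W2(R, P₀)²`. The main steps are `lintegral_sq_sub_real_le`,
`lintegral_sq_clamp_quantile_sub_le`, `lintegral_sq_le_of_almost_antitone` and `W2_le_of_coupling`.
-/

/-! ### Quantile functions. -/

/-- The quantile function (generalized inverse of the distribution function) of `R`. -/
noncomputable def quantile (R : Measure ℝ) (u : ℝ) : ℝ := sInf {t | u ≤ cdf R t}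

theorem quantile_le_iff (R : Measure ℝ) {u t : ℝ} (hu : u ∈ Set.Ioo (0 : ℝ) 1) :
    quantile R u ≤ t ↔ u ≤ cdf R t := by
  have hne : {t | u ≤ cdf R t}.Nonempty := by
    obtain ⟨s, hs⟩ := ((tendsto_cdf_atTop R).eventually (lt_mem_nhds hu.2)).exists
    exact ⟨s, le_of_lt hs⟩
  have hbdd : BddBelow {t | u ≤ cdf R t} := by
    obtain ⟨s, hs⟩ := ((tendsto_cdf_atBot R).eventually (gt_mem_nhds hu.1)).exists
    refine ⟨s, fun t ht => ?_⟩
    by_contra! hlt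
    exact absurd (lt_of_le_of_lt (le_trans ht (monotone_cdf R hlt.le)) hs) (lt_irrefl _)
  refine ⟨fun h => ?_, fun h => csInf_le hbdd h⟩
  refine le_trans ?_ (monotone_cdf R h)
  have hc : Tendsto (cdf R) (nhdsWithin (quantile R u) (Set.Ioi (quantile R u)))
      (nhds (cdf R (quantile R u))) :=
    ((cdf R).right_continuous (quantile R u)).mono_left (nhdsWithin_mono _ Set.Ioi_subset_Ici_self)
  refine ge_of_tendsto hc ?_
  filter_upwards [self_mem_nhdsWithin] with s hs
  obtain ⟨r, hr, hrs⟩ := exists_lt_of_csInf_lt hne hs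
  exact le_trans hr (monotone_cdf R hrs.le)

theorem lt_quantile_iff (R : Measure ℝ) {u t : ℝ} (hu : u ∈ Set.Ioo (0 : ℝ) 1) :
    t < quantile R u ↔ cdf R t < u := by
  rw [← not_le, quantile_le_iff R hu, not_le]

theorem aemeasurable_quantile (R : Measure ℝ) :
    AEMeasurable (quantile R) (volume.restrict (Set.Ioo (0 : ℝ) 1)) := by
  refine aemeasurable_restrict_of_monotoneOn measurableSet_Ioo fun u hu v hv huv => ?_
  rw [quantile_le_iff R hu]
  exact huv.trans ((quantile_le_iff R hv).1 le_rfl)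

theorem map_quantile (R : Measure ℝ) [IsProbabilityMeasure R] :
    (volume.restrict (Set.Ioo (0 : ℝ) 1)).map (quantile R) = R := by
  have : IsFiniteMeasure ((volume.restrict (Set.Ioo (0 : ℝ) 1)).map (quantile R)) := by
    infer_instance
  refine Measure.ext_of_Iic _ _ fun t => ?_
  rw [Measure.map_apply_of_aemeasurable (aemeasurable_quantile R) measurableSet_Iic,
    Measure.restrict_apply' measurableSet_Ioo, ← ofReal_cdf R t]
  apply le_antisymm
  · calc volume (quantile R ⁻¹' Set.Iic t ∩ Set.Ioo 0 1)
        ≤ volume (Set.Ioc 0 (cdf R t)) :=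
          measure_mono fun u hu => ⟨hu.2.1, (quantile_le_iff R hu.2).1 hu.1⟩
      _ = ENNReal.ofReal (cdf R t) := by rw [Real.volume_Ioc, sub_zero]
  · calc ENNReal.ofReal (cdf R t) = volume (Set.Ioo 0 (cdf R t)) := by
          rw [Real.volume_Ioo, sub_zero]
      _ ≤ _ := measure_mono fun u hu => by
          have h1 : u ∈ Set.Ioo (0 : ℝ) 1 := ⟨hu.1, hu.2.trans_le (cdf_le_one R t)⟩
          exact ⟨(quantile_le_iff R h1).2 hu.2.le, h1⟩

/-! ### Transport cost controls the L² distance of distribution functions. -/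

/-- Writing a squared displacement as an integral over the levels it crosses is the link between
transport cost and distribution functions. -/
theorem lintegral_Ico_sub_left {x y : ℝ} (h : x ≤ y) :
    ∫⁻ t in Set.Ico x y, ENNReal.ofReal (t - x) = ENNReal.ofReal ((y - x) ^ 2 / 2) := by
  rw [← ofReal_integral_eq_lintegral_ofReal, integral_Ico_eq_integral_Ioc,
    ← intervalIntegral.integral_of_le h]
  · congr 1
    rw [intervalIntegral.integral_sub (by simp) (by simp), integral_id,
      intervalIntegral.integral_const, smul_eq_mul]
    ring
  · exact (Continuous.integrableOn_Icc (by fun_prop)).mono_set Set.Ico_subset_Icc_self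
  · filter_upwards [ae_restrict_mem measurableSet_Ico] with t ht
    exact sub_nonneg.2 ht.1

theorem lintegral_Ico_sub_right {x y : ℝ} (h : x ≤ y) :
    ∫⁻ t in Set.Ico x y, ENNReal.ofReal (y - t) = ENNReal.ofReal ((y - x) ^ 2 / 2) := by
  rw [← ofReal_integral_eq_lintegral_ofReal, integral_Ico_eq_integral_Ioc,
    ← intervalIntegral.integral_of_le h]
  · congr 1
    rw [intervalIntegral.integral_sub (by simp) (by simp), integral_id,
      intervalIntegral.integral_const, smul_eq_mul]
    ring
  · exact (Continuous.integrableOn_Icc (by fun_prop)).mono_set Set.Ico_subset_Icc_self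
  · filter_upwards [ae_restrict_mem measurableSet_Ico] with t ht
    exact sub_nonneg.2 ht.2.le

section Straddle

variable {Ω : Type*} [MeasurableSpace Ω] {π : Measure Ω} [IsProbabilityMeasure π] {X Y : Ω → ℝ}

/-- If `X` has density at most `M`, mass `A` lying to the left of `t` cannot all be close to `t`: at
least `A / 2` of it is at distance `A / (2M)` or more. So its mean distance to `t` is at least of
order `A² / M`. -/
theorem sq_real_straddle_le (hX : Measurable X) (hY : Measurable Y) {M : ℝ} (hM : 0 < M)
    (hd : ∀ s t, s ≤ t → π.real (X ⁻¹' Set.Ioc s t) ≤ M * (t - s)) (t : ℝ) :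
    ENNReal.ofReal (π.real {ω | X ω ≤ t ∧ t < Y ω} ^ 2) ≤
      ENNReal.ofReal (4 * M) *
        ∫⁻ ω, {ω | X ω ≤ t ∧ t < Y ω}.indicator (fun ω => ENNReal.ofReal (t - X ω)) ω ∂π := by
  set S := {ω | X ω ≤ t ∧ t < Y ω} with hS
  set A := π.real S with hA
  have hA0 : 0 ≤ A := measureReal_nonneg
  -- With this `r`, the strip `(t - r, t]` carries mass at most `M * r = A / 2`.
  set r := A / (2 * M) with hr
  have hr0 : 0 ≤ r := by positivity
  set S' := {ω | X ω ≤ t - r ∧ t < Y ω} with hS'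
  have mS : MeasurableSet S :=
    (measurableSet_le hX measurable_const).inter (measurableSet_lt measurable_const hY)
  have mS' : MeasurableSet S' :=
    (measurableSet_le hX measurable_const).inter (measurableSet_lt measurable_const hY)
  have h1 : A ≤ π.real S' + A / 2 := by
    have hsub : S ⊆ S' ∪ X ⁻¹' Set.Ioc (t - r) t := by
      intro ω hω
      rcases le_or_gt (X ω) (t - r) with h | h
      · exact Or.inl ⟨h, hω.2⟩
      · exact Or.inr ⟨h, hω.1⟩
    have h2 := (measureReal_mono hsub (measure_ne_top _ _)).trans (measureReal_union_le (μ := π) _ _)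
    have h3 := hd (t - r) t (by linarith)
    have h4 : M * (t - (t - r)) = A / 2 := by rw [hr]; field_simp; ring
    linarith
  have hsub : S' ⊆ S := fun ω hω => ⟨by have := hω.1; linarith, hω.2⟩
  calc ENNReal.ofReal (A ^ 2) = ENNReal.ofReal (4 * M) * (ENNReal.ofReal r *
          ENNReal.ofReal (A / 2)) := by
        rw [← ENNReal.ofReal_mul hr0, ← ENNReal.ofReal_mul (by positivity)]
        congr 1; rw [hr]; field_simp; ring
    _ ≤ ENNReal.ofReal (4 * M) * (ENNReal.ofReal r * π S') := by
        gcongr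
        rw [← ofReal_measureReal]
        exact ENNReal.ofReal_le_ofReal (by linarith)
    _ = ENNReal.ofReal (4 * M) * ∫⁻ _ in S', ENNReal.ofReal r ∂π := by
        rw [setLIntegral_const]
    _ ≤ ENNReal.ofReal (4 * M) * ∫⁻ ω in S', ENNReal.ofReal (t - X ω) ∂π := by
        gcongr 1
        refine setLIntegral_mono' mS' fun ω hω => ENNReal.ofReal_le_ofReal ?_
        have := hω.1
        linarith
    _ ≤ ENNReal.ofReal (4 * M) * ∫⁻ ω in S, ENNReal.ofReal (t - X ω) ∂π := by
        gcongr 1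
        exact lintegral_mono_set hsub
    _ = _ := by rw [lintegral_indicator mS]

theorem lintegral_sq_real_straddle_le (hX : Measurable X) (hY : Measurable Y) {M : ℝ} (hM : 0 < M)
    (hd : ∀ s t, s ≤ t → π.real (X ⁻¹' Set.Ioc s t) ≤ M * (t - s)) :
    ∫⁻ t, ENNReal.ofReal (π.real {ω | X ω ≤ t ∧ t < Y ω} ^ 2) ≤
      ENNReal.ofReal (2 * M) * ∫⁻ ω, ENNReal.ofReal ((X ω - Y ω) ^ 2) ∂π := by
  have mk : Measurable fun p : ℝ × Ω => {p : ℝ × Ω | X p.2 ≤ p.1 ∧ p.1 < Y p.2}.indicator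
      (fun p => ENNReal.ofReal (p.1 - X p.2)) p := by
    refine Measurable.indicator (by fun_prop) ?_
    exact (measurableSet_le (hX.comp measurable_snd) measurable_fst).inter
      (measurableSet_lt measurable_fst (hY.comp measurable_snd))
  calc ∫⁻ t, ENNReal.ofReal (π.real {ω | X ω ≤ t ∧ t < Y ω} ^ 2)
      ≤ ∫⁻ t, ENNReal.ofReal (4 * M) *
        ∫⁻ ω, {ω | X ω ≤ t ∧ t < Y ω}.indicator (fun ω => ENNReal.ofReal (t - X ω)) ω ∂π :=
        lintegral_mono fun t => sq_real_straddle_le hX hY hM hd t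
    _ = ENNReal.ofReal (4 * M) * ∫⁻ t,
        ∫⁻ ω, {ω | X ω ≤ t ∧ t < Y ω}.indicator (fun ω => ENNReal.ofReal (t - X ω)) ω ∂π :=
        lintegral_const_mul' _ _ ENNReal.ofReal_ne_top
    _ = ENNReal.ofReal (4 * M) * ∫⁻ ω, (∫⁻ t,
        {ω | X ω ≤ t ∧ t < Y ω}.indicator (fun ω => ENNReal.ofReal (t - X ω)) ω) ∂π := by
        congr 1
        exact lintegral_lintegral_swap mk.aemeasurable
    _ ≤ ENNReal.ofReal (4 * M) * ∫⁻ ω, ENNReal.ofReal ((X ω - Y ω) ^ 2 / 2) ∂π := by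
        gcongr with ω
        have : (fun t => {ω | X ω ≤ t ∧ t < Y ω}.indicator (fun ω => ENNReal.ofReal (t - X ω)) ω) =
            (Set.Ico (X ω) (Y ω)).indicator fun t => ENNReal.ofReal (t - X ω) := by
          ext t
          simp only [Set.indicator, Set.mem_ofPred_eq, Set.mem_Ico]
        rw [this, lintegral_indicator measurableSet_Ico]
        rcases le_or_gt (X ω) (Y ω) with h | h
        · rw [lintegral_Ico_sub_left h]
          exact ENNReal.ofReal_le_ofReal (by nlinarith)
        · simp [Set.Ico_eq_empty_of_le h.le]
    _ = _ := by
        have : ∀ ω, ENNReal.ofReal ((X ω - Y ω) ^ 2 / 2) =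
            ENNReal.ofReal (1 / 2) * ENNReal.ofReal ((X ω - Y ω) ^ 2) := fun ω => by
          rw [← ENNReal.ofReal_mul (by norm_num)]; congr 1; ring
        simp_rw [this]
        rw [lintegral_const_mul' _ _ ENNReal.ofReal_ne_top, ← mul_assoc,
          ← ENNReal.ofReal_mul (by positivity)]
        congr 2; ring

/-- At level `t` the two distribution functions differ by the mass crossing `t` rightwards minus the
mass crossing it leftwards. Both are nonnegative, so the square of the difference is at most the sum
of the squares. -/
theorem lintegral_sq_sub_real_le (hX : Measurable X) (hY : Measurable Y) {M : ℝ} (hM : 0 < M)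
    (hdX : ∀ s t, s ≤ t → π.real (X ⁻¹' Set.Ioc s t) ≤ M * (t - s))
    (hdY : ∀ s t, s ≤ t → π.real (Y ⁻¹' Set.Ioc s t) ≤ M * (t - s)) :
    ∫⁻ t, ENNReal.ofReal ((π.real (X ⁻¹' Set.Iic t) - π.real (Y ⁻¹' Set.Iic t)) ^ 2) ≤
      ENNReal.ofReal (4 * M) * ∫⁻ ω, ENNReal.ofReal ((X ω - Y ω) ^ 2) ∂π := by
  have hdec : ∀ (U V : Ω → ℝ), Measurable V → ∀ t, π.real (U ⁻¹' Set.Iic t) =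
      π.real (U ⁻¹' Set.Iic t ∩ V ⁻¹' Set.Iic t) + π.real {ω | U ω ≤ t ∧ t < V ω} := by
    intro U V hV t
    rw [← measureReal_inter_add_sdiff (s := U ⁻¹' Set.Iic t) (hV measurableSet_Iic)]
    congr 2
    ext ω; simp
  have hpt : ∀ t, ENNReal.ofReal ((π.real (X ⁻¹' Set.Iic t) - π.real (Y ⁻¹' Set.Iic t)) ^ 2) ≤
      ENNReal.ofReal (π.real {ω | X ω ≤ t ∧ t < Y ω} ^ 2) +
      ENNReal.ofReal (π.real {ω | Y ω ≤ t ∧ t < X ω} ^ 2) := by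
    intro t
    rw [← ENNReal.ofReal_add (by positivity) (by positivity)]
    apply ENNReal.ofReal_le_ofReal
    rw [hdec X Y hY t, hdec Y X hX t, Set.inter_comm]
    have h1 : 0 ≤ π.real {ω | X ω ≤ t ∧ t < Y ω} := measureReal_nonneg
    have h2 : 0 ≤ π.real {ω | Y ω ≤ t ∧ t < X ω} := measureReal_nonneg
    nlinarith [mul_nonneg h1 h2]
  have mA : Measurable fun t => ENNReal.ofReal (π.real {ω | X ω ≤ t ∧ t < Y ω} ^ 2) := by
    have hm : MeasurableSet {p : ℝ × Ω | X p.2 ≤ p.1 ∧ p.1 < Y p.2} :=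
      (measurableSet_le (hX.comp measurable_snd) measurable_fst).inter
        (measurableSet_lt measurable_fst (hY.comp measurable_snd))
    have := measurable_measure_prodMk_left (ν := π) hm
    exact (this.ennreal_toReal.pow_const 2).ennreal_ofReal
  refine (lintegral_mono hpt).trans ?_
  rw [lintegral_add_left mA]
  refine (add_le_add (lintegral_sq_real_straddle_le hX hY hM hdX)
    (lintegral_sq_real_straddle_le hY hX hM hdY)).trans ?_
  simp_rw [fun ω => show (Y ω - X ω) ^ 2 = (X ω - Y ω) ^ 2 by ring]
  rw [← add_mul, ← ENNReal.ofReal_add (by positivity) (by positivity)]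
  apply le_of_eq; congr 2; ring

end Straddle

/-! ### From distribution functions back to transport cost. -/

/-- Projection of the line onto `[-a, a]`. -/
noncomputable def clamp (a x : ℝ) : ℝ := max (-a) (min x a)

/-- Every level `t` between the two quantiles at `u` has `u` between `cdf R t` and `cdf P₀ t`, and
the lower density bound `m` places `t` within `|cdf R t - cdf P₀ t| / m` of the quantile of `P₀`. By
Fubini, each `t` contributes this distance times the length `|cdf R t - cdf P₀ t|` of the admissible
range of `u`. -/
theorem lintegral_sq_clamp_quantile_sub_le {R P₀ : Measure ℝ} [IsProbabilityMeasure R]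
    [IsProbabilityMeasure P₀] {a m : ℝ} (ha : 0 < a) (hm : 0 < m)
    (hleft : ∀ t < -a, cdf P₀ t = 0) (hright : cdf P₀ a = 1)
    (hdens : ∀ s t, -a ≤ s → s ≤ t → t ≤ a → m * (t - s) ≤ cdf P₀ t - cdf P₀ s) :
    ∫⁻ u in Set.Ioo (0 : ℝ) 1, ENNReal.ofReal ((clamp a (quantile R u) - quantile P₀ u) ^ 2) ≤
      ENNReal.ofReal (2 / m) *
        ∫⁻ t in Set.Icc (-a) a, ENNReal.ofReal ((cdf R t - cdf P₀ t) ^ 2) := by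
  let T : Set (ℝ × ℝ) := {p | p.2 ∈ Set.Icc (-a) a ∧ p.1 ∈ Set.uIoc (cdf R p.2) (cdf P₀ p.2)}
  set K : ℝ → ℝ → ℝ≥0∞ := fun u t =>
    T.indicator (fun p => ENNReal.ofReal (|cdf R p.2 - cdf P₀ p.2| / m)) (u, t) with hK
  have mR : Measurable (cdf R) := (monotone_cdf R).measurable
  have mP : Measurable (cdf P₀) := (monotone_cdf P₀).measurable
  have mK : Measurable (Function.uncurry K) := by
    refine Measurable.indicator (by fun_prop) ?_
    refine MeasurableSet.inter (measurableSet_Icc.preimage measurable_snd) ?_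
    exact (measurableSet_lt ((mR.comp measurable_snd).min (mP.comp measurable_snd))
      measurable_fst).inter
      (measurableSet_le measurable_fst ((mR.comp measurable_snd).max (mP.comp measurable_snd)))
  have hpt : ∀ u ∈ Set.Ioo (0 : ℝ) 1,
      ENNReal.ofReal ((clamp a (quantile R u) - quantile P₀ u) ^ 2) ≤
        ENNReal.ofReal 2 * ∫⁻ t, K u t := by
    intro u hu
    set x := clamp a (quantile R u) with hx
    set y := quantile P₀ u with hy
    have hya : -a ≤ y := by
      by_contra! h
      obtain ⟨s, hs1, hs2⟩ := exists_between h
      have := (quantile_le_iff P₀ hu).1 hs1.le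
      rw [hleft s hs2] at this
      exact absurd hu.1 (not_lt.2 this)
    have hyb : y ≤ a := (quantile_le_iff P₀ hu).2 (hright ▸ hu.2.le)
    have hsq : ∀ d : ℝ, ENNReal.ofReal (d ^ 2) = ENNReal.ofReal 2 * ENNReal.ofReal (d ^ 2 / 2) := by
      intro d
      rw [← ENNReal.ofReal_mul (by norm_num)]; congr 1; ring
    rcases le_total y x with h | h
    · rw [hsq, ← lintegral_Ico_sub_left h, ← lintegral_indicator measurableSet_Ico]
      gcongr 2 with t
      refine Set.indicator_le (fun t ht => ?_) t
      have h1 : t < a := ht.2.trans_le (max_le (by linarith) (min_le_right _ _))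
      have h2 : t < quantile R u := by
        rcases lt_max_iff.1 ht.2 with h | h
        · linarith [ht.1]
        · exact h.trans_le (min_le_left _ _)
      have h3 := (lt_quantile_iff R hu).1 h2
      have h4 := (quantile_le_iff P₀ hu).1 ht.1
      rw [hK]
      simp only
      rw [Set.indicator_of_mem]
      swap
      · exact ⟨⟨hya.trans ht.1, h1.le⟩, Set.mem_uIoc.2 (Or.inl ⟨h3, h4⟩)⟩
      apply ENNReal.ofReal_le_ofReal
      rw [le_div_iff₀ hm, mul_comm]
      have h5 := hdens y t hya ht.1 h1.le
      have h6 := (quantile_le_iff P₀ hu).1 (le_refl y)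
      have h7 := neg_abs_le (cdf R t - cdf P₀ t)
      linarith
    · rw [show (x - y) ^ 2 = (y - x) ^ 2 by ring, hsq, ← lintegral_Ico_sub_right h,
        ← lintegral_indicator measurableSet_Ico]
      gcongr 2 with t
      refine Set.indicator_le (fun t ht => ?_) t
      have h0 : -a ≤ t := (le_max_left _ _).trans ht.1
      have h1 : t < a := ht.2.trans_le hyb
      have h2 : quantile R u ≤ t := by
        rcases min_le_iff.1 ((le_max_right _ _).trans ht.1) with h | h
        · exact h
        · linarith
      have h3 := (quantile_le_iff R hu).1 h2
      have h4 := (lt_quantile_iff P₀ hu).1 ht.2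
      rw [hK]
      simp only
      rw [Set.indicator_of_mem]
      swap
      · exact ⟨⟨h0, h1.le⟩, Set.mem_uIoc.2 (Or.inr ⟨h4, h3⟩)⟩
      apply ENNReal.ofReal_le_ofReal
      rw [le_div_iff₀ hm, ← le_div_iff₀ hm]
      have h7 := le_abs_self (cdf R t - cdf P₀ t)
      -- Below the quantile `y` one knows only `cdf P₀ s < u`, so the bound is proved for all `s <
      -- y` and passed to the supremum, without continuity of `cdf P₀`.
      suffices hys : y ≤ t + (u - cdf P₀ t) / m by
        have : (u - cdf P₀ t) / m ≤ |cdf R t - cdf P₀ t| / m := by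
          gcongr; linarith
        linarith
      refine le_of_forall_lt fun s hs => ?_
      rcases le_or_gt s t with hst | hst
      · have : 0 < (u - cdf P₀ t) / m := div_pos (by linarith) hm
        linarith
      · have h5 := hdens t s h0 hst.le (hs.le.trans hyb)
        have h6 := (lt_quantile_iff P₀ hu).1 hs
        rw [← sub_lt_iff_lt_add', lt_div_iff₀ hm]
        linarith
  calc ∫⁻ u in Set.Ioo (0 : ℝ) 1, ENNReal.ofReal ((clamp a (quantile R u) - quantile P₀ u) ^ 2)
      ≤ ∫⁻ u in Set.Ioo (0 : ℝ) 1, ENNReal.ofReal 2 * ∫⁻ t, K u t :=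
        setLIntegral_mono' measurableSet_Ioo hpt
    _ ≤ ∫⁻ u, ENNReal.ofReal 2 * ∫⁻ t, K u t := setLIntegral_le_lintegral _ _
    _ = ENNReal.ofReal 2 * ∫⁻ u, ∫⁻ t, K u t := lintegral_const_mul' _ _ ENNReal.ofReal_ne_top
    _ = ENNReal.ofReal 2 * ∫⁻ t, ∫⁻ u, K u t := by
        rw [lintegral_lintegral_swap mK.aemeasurable]
    _ = ENNReal.ofReal 2 * ∫⁻ t, (Set.Icc (-a) a).indicator (fun t =>
          ENNReal.ofReal (1 / m) * ENNReal.ofReal ((cdf R t - cdf P₀ t) ^ 2)) t := by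
        congr 2 with t
        by_cases ht : t ∈ Set.Icc (-a) a
        · rw [Set.indicator_of_mem ht]
          have : (fun u => K u t) = (Set.uIoc (cdf R t) (cdf P₀ t)).indicator
              fun _ => ENNReal.ofReal (|cdf R t - cdf P₀ t| / m) := by
            ext u
            by_cases hu : u ∈ Set.uIoc (cdf R t) (cdf P₀ t)
            · rw [Set.indicator_of_mem hu]
              have hT : (u, t) ∈ T := ⟨ht, hu⟩
              exact Set.indicator_of_mem hT _
            · rw [Set.indicator_of_notMem hu]
              have hT : (u, t) ∉ T := fun h => hu h.2
              exact Set.indicator_of_notMem hT _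
          rw [this, lintegral_indicator measurableSet_uIoc, setLIntegral_const, Real.volume_uIoc,
            abs_sub_comm, ← ENNReal.ofReal_mul (by positivity), ← ENNReal.ofReal_mul (by positivity)]
          congr 1
          rw [div_mul_eq_mul_div, ← sq, sq_abs]
          ring
        · have : (fun u => K u t) = 0 := by
            ext u
            have hT : (u, t) ∉ T := fun h => ht h.1
            exact Set.indicator_of_notMem hT _
          rw [this, Set.indicator_of_notMem ht, Pi.zero_def, lintegral_zero]
    _ = _ := by
        rw [lintegral_indicator measurableSet_Icc, lintegral_const_mul' _ _ ENNReal.ofReal_ne_top,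
          ← mul_assoc, ← ENNReal.ofReal_mul (by norm_num)]
        congr 2; ring

/-! ### An L² bound for almost antitone functions. -/

/-- On `[0, s₀]` the square of `D` is integrated directly through `hnear`. Beyond `s₀`, every value
is dominated up to `κ` by all values on `[0, s₀]`, hence by their quadratic mean, which is where the
division by `s₀` arises. -/
theorem lintegral_sq_le_of_almost_antitone {D E : ℝ → ℝ}
    {a s₀ κ C w : ℝ} (hs₀ : 0 < s₀) (hsa : s₀ ≤ a) (hw : 0 ≤ w)
    (hmono : ∀ s t, 0 ≤ s → s ≤ t → t ≤ a → |D t| ≤ |D s| + κ)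
    (hnear : ∀ t, 0 ≤ t → t ≤ s₀ → |D t| ≤ |E t| + κ + C * t ^ 2)
    (hEw : ∫⁻ t in Set.Icc 0 a, ENNReal.ofReal (E t ^ 2) ≤ ENNReal.ofReal w) :
    ∫⁻ t in Set.Icc 0 a, ENNReal.ofReal (D t ^ 2) ≤ ENNReal.ofReal
      ((3 * w + 3 * κ ^ 2 * s₀ + 3 * C ^ 2 * s₀ ^ 5) +
        a * (2 * (3 * w + 3 * κ ^ 2 * s₀ + 3 * C ^ 2 * s₀ ^ 5) / s₀ + 2 * κ ^ 2)) := by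
  set J := 3 * w + 3 * κ ^ 2 * s₀ + 3 * C ^ 2 * s₀ ^ 5 with hJ
  have hJ0 : 0 ≤ J := by positivity
  have ha : 0 < a := hs₀.trans_le hsa
  have hnearJ : ∫⁻ t in Set.Icc 0 s₀, ENNReal.ofReal (D t ^ 2) ≤ ENNReal.ofReal J := by
    calc ∫⁻ t in Set.Icc 0 s₀, ENNReal.ofReal (D t ^ 2)
        ≤ ∫⁻ t in Set.Icc 0 s₀, (ENNReal.ofReal 3 * ENNReal.ofReal (E t ^ 2) +
            ENNReal.ofReal (3 * κ ^ 2 + 3 * C ^ 2 * s₀ ^ 4)) := by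
          refine setLIntegral_mono' measurableSet_Icc fun t ht => ?_
          rw [← ENNReal.ofReal_mul (by norm_num), ← ENNReal.ofReal_add (by positivity)
            (by positivity)]
          apply ENNReal.ofReal_le_ofReal
          have h1 := hnear t ht.1 ht.2
          have h2 : (C * t ^ 2) ^ 2 ≤ C ^ 2 * s₀ ^ 4 := by
            have : t ^ 4 ≤ s₀ ^ 4 := pow_le_pow_left₀ ht.1 ht.2 4
            nlinarith [mul_le_mul_of_nonneg_left this (sq_nonneg C)]
          have h3 : D t ^ 2 ≤ (|E t| + κ + C * t ^ 2) ^ 2 := by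
            rw [← sq_abs (D t)]
            exact pow_le_pow_left₀ (abs_nonneg _) h1 2
          have h4 := sq_abs (E t)
          nlinarith [sq_nonneg (|E t| - κ), sq_nonneg (|E t| - C * t ^ 2),
            sq_nonneg (κ - C * t ^ 2)]
      _ = ENNReal.ofReal 3 * (∫⁻ t in Set.Icc 0 s₀, ENNReal.ofReal (E t ^ 2)) +
            ENNReal.ofReal (3 * κ ^ 2 + 3 * C ^ 2 * s₀ ^ 4) * ENNReal.ofReal s₀ := by
          rw [lintegral_add_right _ measurable_const, setLIntegral_const, Real.volume_Icc, sub_zero,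
            lintegral_const_mul' _ _ ENNReal.ofReal_ne_top]
      _ ≤ ENNReal.ofReal 3 * ENNReal.ofReal w +
            ENNReal.ofReal (3 * κ ^ 2 + 3 * C ^ 2 * s₀ ^ 4) * ENNReal.ofReal s₀ := by
          gcongr
          exact (lintegral_mono_set (Set.Icc_subset_Icc_right hsa)).trans hEw
      _ = ENNReal.ofReal J := by
          rw [← ENNReal.ofReal_mul (by norm_num), ← ENNReal.ofReal_mul (by positivity),
            ← ENNReal.ofReal_add (by positivity) (by positivity)]
          congr 1; rw [hJ]; ring
  have hfar : ∀ t, s₀ ≤ t → t ≤ a → D t ^ 2 ≤ 2 * J / s₀ + 2 * κ ^ 2 := by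
    intro t ht hta
    -- Average `hmono` over all `s` in `[0, s₀]`.
    have : ENNReal.ofReal (D t ^ 2 * s₀) ≤ ENNReal.ofReal (2 * J + 2 * κ ^ 2 * s₀) := by
      calc ENNReal.ofReal (D t ^ 2 * s₀) = ∫⁻ _ in Set.Icc 0 s₀, ENNReal.ofReal (D t ^ 2) := by
            rw [setLIntegral_const, Real.volume_Icc, sub_zero, ENNReal.ofReal_mul (by positivity)]
        _ ≤ ∫⁻ s in Set.Icc 0 s₀, (ENNReal.ofReal 2 * ENNReal.ofReal (D s ^ 2) +
              ENNReal.ofReal (2 * κ ^ 2)) := by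
            refine setLIntegral_mono' measurableSet_Icc fun s hs => ?_
            rw [← ENNReal.ofReal_mul (by norm_num), ← ENNReal.ofReal_add (by positivity)
              (by positivity)]
            apply ENNReal.ofReal_le_ofReal
            have h1 := hmono s t hs.1 (hs.2.trans ht) hta
            have h3 : D t ^ 2 ≤ (|D s| + κ) ^ 2 := by
              rw [← sq_abs (D t)]
              exact pow_le_pow_left₀ (abs_nonneg _) h1 2
            nlinarith [sq_nonneg (|D s| - κ), sq_abs (D s)]
        _ = ENNReal.ofReal 2 * (∫⁻ s in Set.Icc 0 s₀, ENNReal.ofReal (D s ^ 2)) +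
              ENNReal.ofReal (2 * κ ^ 2) * ENNReal.ofReal s₀ := by
            rw [lintegral_add_right _ measurable_const, setLIntegral_const, Real.volume_Icc,
              sub_zero, lintegral_const_mul' _ _ ENNReal.ofReal_ne_top]
        _ ≤ ENNReal.ofReal 2 * ENNReal.ofReal J +
              ENNReal.ofReal (2 * κ ^ 2) * ENNReal.ofReal s₀ := by gcongr
        _ = _ := by
            rw [← ENNReal.ofReal_mul (by norm_num), ← ENNReal.ofReal_mul (by positivity),
              ← ENNReal.ofReal_add (by positivity) (by positivity)]
    rw [ENNReal.ofReal_le_ofReal_iff (by positivity), ← le_div_iff₀ hs₀] at this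
    refine this.trans (le_of_eq ?_)
    field_simp
  calc ∫⁻ t in Set.Icc 0 a, ENNReal.ofReal (D t ^ 2)
      ≤ ∫⁻ t in Set.Icc 0 s₀ ∪ Set.Icc s₀ a, ENNReal.ofReal (D t ^ 2) :=
        lintegral_mono_set Set.Icc_subset_Icc_union_Icc
    _ ≤ (∫⁻ t in Set.Icc 0 s₀, ENNReal.ofReal (D t ^ 2)) +
          ∫⁻ t in Set.Icc s₀ a, ENNReal.ofReal (D t ^ 2) := lintegral_union_le _ _ _
    _ ≤ ENNReal.ofReal J + ∫⁻ t in Set.Icc s₀ a, ENNReal.ofReal (2 * J / s₀ + 2 * κ ^ 2) := by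
        gcongr 1
        exact setLIntegral_mono' measurableSet_Icc fun t ht =>
          ENNReal.ofReal_le_ofReal (hfar t ht.1 ht.2)
    _ ≤ ENNReal.ofReal J + ENNReal.ofReal (2 * J / s₀ + 2 * κ ^ 2) * ENNReal.ofReal a := by
        rw [setLIntegral_const, Real.volume_Icc]
        gcongr
        linarith
    _ = _ := by
        rw [← ENNReal.ofReal_mul (by positivity), ← ENNReal.ofReal_add (by positivity)
          (by positivity), mul_comm a]

/-! ### Costs of couplings and the quantile coupling. -/

theorem cdf_sub_cdf (R : Measure ℝ) [IsProbabilityMeasure R] {s t : ℝ} (h : s ≤ t) :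
    cdf R t - cdf R s = R.real (Set.Ioc s t) := by
  rw [cdf_eq_real, cdf_eq_real, ← Set.Iic_sdiff_Iic,
    measureReal_sdiff (Set.Iic_subset_Iic.2 h) measurableSet_Iic]

theorem one_sub_cdf (R : Measure ℝ) [IsProbabilityMeasure R] (t : ℝ) :
    1 - cdf R t = R.real (Set.Ioi t) := by
  rw [cdf_eq_real, ← Set.compl_Iic, probReal_compl_eq_one_sub measurableSet_Iic]

theorem setLIntegral_Icc_comp_neg (φ : ℝ → ℝ≥0∞) (a : ℝ) :
    ∫⁻ t in Set.Icc 0 a, φ (-t) = ∫⁻ t in Set.Icc (-a) 0, φ t := by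
  have := (Measure.measurePreserving_neg (volume : Measure ℝ)).setLIntegral_comp_preimage_emb
    (MeasurableEquiv.neg ℝ).measurableEmbedding φ (Set.Icc (-a) 0)
  simpa using this

/-- Mass of `R` to the left of `-a` must be moved at least to `-a` to reach `S`, and clamping moves
it exactly there; on the right there is nothing to clamp. -/
theorem lintegral_sq_sub_clamp_le {R S : Measure ℝ} {a : ℝ}
    (hRa : R (Set.Ioi a) = 0) (hSa : S (Set.Iio (-a)) = 0)
    {π : Measure (ℝ × ℝ)} (hπ : π ∈ couplings R S) :
    (∫⁻ x, ENNReal.ofReal ((x - clamp a x) ^ 2) ∂(R)) ≤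
      ∫⁻ z, ENNReal.ofReal ((z.1 - z.2) ^ 2) ∂π := by
  have hm : Measurable fun x : ℝ => ENNReal.ofReal ((x - clamp a x) ^ 2) := by
    unfold clamp; fun_prop
  have h1 : ∀ᵐ z ∂π, z.1 ≤ a := by
    have : ∀ᵐ x ∂(π.map Prod.fst), x ≤ a := by
      rw [hπ.1, ae_iff]; simpa [Set.Ioi] using hRa
    exact ae_of_ae_map measurable_fst.aemeasurable this
  have h2 : ∀ᵐ z ∂π, -a ≤ z.2 := by
    have : ∀ᵐ x ∂(π.map Prod.snd), -a ≤ x := by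
      rw [hπ.2, ae_iff]; simpa [Set.Iio] using hSa
    exact ae_of_ae_map measurable_snd.aemeasurable this
  rw [← hπ.1, lintegral_map hm measurable_fst]
  refine lintegral_mono_ae ?_
  filter_upwards [h1, h2] with z hz1 hz2
  apply ENNReal.ofReal_le_ofReal
  rw [clamp, min_eq_left hz1]
  rcases le_total (-a) z.1 with h | h
  · rw [max_eq_right h]; simp [sq_nonneg]
  · rw [max_eq_left h]; nlinarith

/-- The quantile coupling of `R` and `P₀` is estimated through the clamped quantile of `R`: clamping
is paid for by the given coupling with `S`, the remainder by the distribution functions on `[-a,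
a]`. -/
theorem iInf_couplings_le_clamp {R S P₀ : Measure ℝ} [IsProbabilityMeasure R]
    [IsProbabilityMeasure P₀] {a m : ℝ} (ha : 0 < a) (hm : 0 < m)
    (hleft : ∀ t < -a, cdf P₀ t = 0) (hright : cdf P₀ a = 1)
    (hdens : ∀ s t, -a ≤ s → s ≤ t → t ≤ a → m * (t - s) ≤ cdf P₀ t - cdf P₀ s)
    (hRa : R (Set.Ioi a) = 0) (hSa : S (Set.Iio (-a)) = 0)
    {π : Measure (ℝ × ℝ)} (hπ : π ∈ couplings R S) :
    ⨅ π ∈ couplings R P₀, ∫⁻ z, ENNReal.ofReal ((z.1 - z.2) ^ 2) ∂π ≤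
      ENNReal.ofReal 2 * (∫⁻ z, ENNReal.ofReal ((z.1 - z.2) ^ 2) ∂π) +
      ENNReal.ofReal (4 / m) *
        ∫⁻ t in Set.Icc (-a) a, ENNReal.ofReal ((cdf R t - cdf P₀ t) ^ 2) := by
  have hq : AEMeasurable (fun u => (quantile R u, quantile P₀ u))
      (volume.restrict (Set.Ioo (0 : ℝ) 1)) :=
    (aemeasurable_quantile R).prodMk (aemeasurable_quantile P₀)
  refine (iInf₂_le ((volume.restrict (Set.Ioo (0 : ℝ) 1)).map
    fun u => (quantile R u, quantile P₀ u)) ⟨?h1, ?h2⟩).trans ?h3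
  case h1 =>
    rw [AEMeasurable.map_map_of_aemeasurable measurable_fst.aemeasurable hq]
    exact map_quantile R
  case h2 =>
    rw [AEMeasurable.map_map_of_aemeasurable measurable_snd.aemeasurable hq]
    exact map_quantile P₀
  have hcl : Measurable (clamp a) := by unfold clamp; fun_prop
  rw [lintegral_map' (by fun_prop) hq]
  calc ∫⁻ u in Set.Ioo (0 : ℝ) 1, ENNReal.ofReal ((quantile R u - quantile P₀ u) ^ 2)
      ≤ ∫⁻ u in Set.Ioo (0 : ℝ) 1,
          (ENNReal.ofReal 2 * ENNReal.ofReal ((quantile R u - clamp a (quantile R u)) ^ 2) +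
          ENNReal.ofReal 2 * ENNReal.ofReal ((clamp a (quantile R u) - quantile P₀ u) ^ 2)) := by
        refine lintegral_mono fun u => ?_
        rw [← ENNReal.ofReal_mul (by norm_num), ← ENNReal.ofReal_mul (by norm_num),
          ← ENNReal.ofReal_add (by positivity) (by positivity)]
        apply ENNReal.ofReal_le_ofReal
        nlinarith [sq_nonneg ((quantile R u - clamp a (quantile R u)) -
          (clamp a (quantile R u) - quantile P₀ u))]
    _ = ENNReal.ofReal 2 * (∫⁻ x, ENNReal.ofReal ((x - clamp a x) ^ 2) ∂(R)) +
          ENNReal.ofReal 2 * ∫⁻ u in Set.Ioo (0 : ℝ) 1,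
            ENNReal.ofReal ((clamp a (quantile R u) - quantile P₀ u) ^ 2) := by
        have h1 := aemeasurable_quantile R
        have h2 : AEMeasurable (fun u => clamp a (quantile R u))
            (volume.restrict (Set.Ioo (0 : ℝ) 1)) := hcl.comp_aemeasurable h1
        rw [lintegral_add_left' (by fun_prop), lintegral_const_mul' _ _ ENNReal.ofReal_ne_top,
          lintegral_const_mul' _ _ ENNReal.ofReal_ne_top]
        conv_rhs => rw [← map_quantile R]
        rw [lintegral_map' (by fun_prop) h1, map_quantile R]
    _ ≤ ENNReal.ofReal 2 * (∫⁻ z, ENNReal.ofReal ((z.1 - z.2) ^ 2) ∂π) +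
          ENNReal.ofReal 2 * (ENNReal.ofReal (2 / m) *
            ∫⁻ t in Set.Icc (-a) a, ENNReal.ofReal ((cdf R t - cdf P₀ t) ^ 2)) := by
        gcongr ?_ * ?_ + _ * ?_
        · exact le_rfl
        · exact lintegral_sq_sub_clamp_le hRa hSa hπ
        · exact lintegral_sq_clamp_quantile_sub_le ha hm hleft hright hdens
    _ = _ := by
        rw [← mul_assoc, ← ENNReal.ofReal_mul (by norm_num)]
        congr 3; ring

theorem lintegral_sq_cdf_sub_le_of_coupling {R S : Measure ℝ} [IsProbabilityMeasure R]
    [IsProbabilityMeasure S] {M : ℝ} (hM : 0 < M)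
    (hR : ∀ s t, s ≤ t → R.real (Set.Ioc s t) ≤ M * (t - s))
    (hS : ∀ s t, s ≤ t → S.real (Set.Ioc s t) ≤ M * (t - s))
    {π : Measure (ℝ × ℝ)} (hπ : π ∈ couplings R S) :
    ∫⁻ t, ENNReal.ofReal ((cdf R t - cdf S t) ^ 2) ≤
      ENNReal.ofReal (4 * M) * ∫⁻ z, ENNReal.ofReal ((z.1 - z.2) ^ 2) ∂π := by
  have h1 : ∀ A, MeasurableSet A → π.real (Prod.fst ⁻¹' A) = R.real A := fun A hA => by
    rw [← map_measureReal_apply measurable_fst hA, hπ.1]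
  have h2 : ∀ A, MeasurableSet A → π.real (Prod.snd ⁻¹' A) = S.real A := fun A hA => by
    rw [← map_measureReal_apply measurable_snd hA, hπ.2]
  have : IsProbabilityMeasure π := by
    refine ⟨?_⟩
    have : π.map Prod.fst Set.univ = 1 := by rw [hπ.1]; exact measure_univ
    rwa [Measure.map_apply measurable_fst MeasurableSet.univ, Set.preimage_univ] at this
  simp_rw [cdf_eq_real, ← h1 _ measurableSet_Iic, ← h2 _ measurableSet_Iic]
  refine lintegral_sq_sub_real_le measurable_fst measurable_snd hM ?_ ?_
  · intro s t h; rw [h1 _ measurableSet_Ioc]; exact hR s t h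
  · intro s t h; rw [h2 _ measurableSet_Ioc]; exact hS s t h

/-! ### Stability around the common core. -/

/-- The bound on `∫₀ᵃ D²` for an almost antitone `D`, as a function of `∫ E²`. -/
noncomputable def halfLineBound (a s₀ κ C w : ℝ) : ℝ :=
  (3 * w + 3 * κ ^ 2 * s₀ + 3 * C ^ 2 * s₀ ^ 5) +
    a * (2 * (3 * w + 3 * κ ^ 2 * s₀ + 3 * C ^ 2 * s₀ ^ 5) / s₀ + 2 * κ ^ 2)

section Core

variable {R S P₀ : Measure ℝ} [IsProbabilityMeasure R] [IsProbabilityMeasure S]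
  [IsProbabilityMeasure P₀] {a κ L s₀ w : ℝ}

/-- Domination of `R` on `[0, ∞)` makes `cdf R - cdf P₀` almost antitone and, through tails, at
least `-κ` there. Near `0` its upper bound comes from `S`, dominated by `(1 + κ) P₀` on the left of
`0` and up to `L t²` on `(0, t]`. The factor `2 * L` absorbs `1 + κ ≤ 2`. -/
theorem lintegral_sq_cdf_sub_right_le (hκ₀ : 0 ≤ κ) (hκ₁ : κ ≤ 1) (hL : 0 ≤ L)
    (hs₀ : 0 < s₀) (hsa : s₀ ≤ a) (hw : 0 ≤ w)
    (hR : ∀ A ⊆ Set.Ici 0, MeasurableSet A → R.real A ≤ (1 + κ) * P₀.real A)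
    (hS : ∀ A ⊆ Set.Iic 0, MeasurableSet A → S.real A ≤ (1 + κ) * P₀.real A)
    (hSn : ∀ t, 0 ≤ t → t ≤ s₀ →
      S.real (Set.Ioc 0 t) ≤ (1 + κ) * (P₀.real (Set.Ioc 0 t) + L * t ^ 2))
    (hE : ∫⁻ t, ENNReal.ofReal ((cdf R t - cdf S t) ^ 2) ≤ ENNReal.ofReal w) :
    ∫⁻ t in Set.Icc 0 a, ENNReal.ofReal ((cdf R t - cdf P₀ t) ^ 2) ≤
      ENNReal.ofReal (halfLineBound a s₀ κ (2 * L) w) := by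
  have hlow : ∀ t, 0 ≤ t → -κ ≤ cdf R t - cdf P₀ t := by
    intro t ht
    have h1 := hR (Set.Ioi t) (fun x hx => ht.trans (le_of_lt hx)) measurableSet_Ioi
    rw [← one_sub_cdf, ← one_sub_cdf] at h1
    nlinarith [mul_nonneg hκ₀ (cdf_nonneg P₀ t)]
  refine lintegral_sq_le_of_almost_antitone (E := fun t => cdf R t - cdf S t) hs₀ hsa hw ?_ ?_
    ((setLIntegral_le_lintegral _ _).trans hE)
  · intro s t hs hst _
    have h1 := hR (Set.Ioc s t) (fun x hx => hs.trans (le_of_lt hx.1)) measurableSet_Ioc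
    rw [← cdf_sub_cdf R hst, ← cdf_sub_cdf P₀ hst] at h1
    have h2 : κ * (cdf P₀ t - cdf P₀ s) ≤ κ := by
      nlinarith [cdf_nonneg P₀ s, cdf_le_one P₀ t]
    have h3 := hlow t (hs.trans hst)
    rw [abs_le]
    constructor
    · linarith [abs_nonneg (cdf R s - cdf P₀ s)]
    · linarith [le_abs_self (cdf R s - cdf P₀ s)]
  · intro t ht hts
    have h1 := hS (Set.Iic 0) le_rfl measurableSet_Iic
    rw [← cdf_eq_real, ← cdf_eq_real] at h1
    have h2 := hSn t ht hts
    rw [← cdf_sub_cdf S ht, ← cdf_sub_cdf P₀ ht] at h2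
    have h3 := hlow t ht
    have h4 : κ * cdf P₀ t ≤ κ := by nlinarith [cdf_le_one P₀ t]
    have h5 : κ * (L * t ^ 2) ≤ L * t ^ 2 := by
      have : 0 ≤ L * t ^ 2 := by positivity
      nlinarith
    have h6 : 0 ≤ L * t ^ 2 := by positivity
    rw [abs_le]
    constructor
    · linarith [abs_nonneg (cdf R t - cdf S t)]
    · linarith [le_abs_self (cdf R t - cdf S t)]

/-- Mirror image of the right half-line. Here it is `S` that is dominated by `P₀`, so the bound is
for `cdf S`; the passage to `cdf R` costs a further `∫ (cdf R - cdf S)²`. -/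
theorem lintegral_sq_cdf_sub_left_le (hκ₀ : 0 ≤ κ) (hκ₁ : κ ≤ 1) (hL : 0 ≤ L)
    (hs₀ : 0 < s₀) (hsa : s₀ ≤ a) (hw : 0 ≤ w)
    (hR : ∀ A ⊆ Set.Ici 0, MeasurableSet A → R.real A ≤ (1 + κ) * P₀.real A)
    (hS : ∀ A ⊆ Set.Iic 0, MeasurableSet A → S.real A ≤ (1 + κ) * P₀.real A)
    (hRn : ∀ t, 0 ≤ t → t ≤ s₀ →
      R.real (Set.Ioc (-t) 0) ≤ (1 + κ) * (P₀.real (Set.Ioc (-t) 0) + L * t ^ 2))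
    (hE : ∫⁻ t, ENNReal.ofReal ((cdf R t - cdf S t) ^ 2) ≤ ENNReal.ofReal w) :
    ∫⁻ t in Set.Icc (-a) 0, ENNReal.ofReal ((cdf S t - cdf P₀ t) ^ 2) ≤
      ENNReal.ofReal (halfLineBound a s₀ κ (2 * L) w) := by
  have hup : ∀ t, t ≤ 0 → cdf S t - cdf P₀ t ≤ κ := by
    intro t ht
    have h1 := hS (Set.Iic t) (Set.Iic_subset_Iic.2 ht) measurableSet_Iic
    rw [← cdf_eq_real, ← cdf_eq_real] at h1
    nlinarith [cdf_le_one P₀ t]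
  rw [← setLIntegral_Icc_comp_neg]
  refine lintegral_sq_le_of_almost_antitone (D := fun t => cdf S (-t) - cdf P₀ (-t))
    (E := fun t => cdf R (-t) - cdf S (-t)) hs₀ hsa hw ?_ ?_ ?_
  · intro s t hs hst _
    have hst' : -t ≤ -s := neg_le_neg hst
    have h1 := hS (Set.Ioc (-t) (-s)) (fun x hx => hx.2.trans (by linarith)) measurableSet_Ioc
    rw [← cdf_sub_cdf S hst', ← cdf_sub_cdf P₀ hst'] at h1
    have h2 : κ * (cdf P₀ (-s) - cdf P₀ (-t)) ≤ κ := by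
      nlinarith [cdf_nonneg P₀ (-t), cdf_le_one P₀ (-s)]
    have h3 := hup (-t) (by linarith)
    rw [abs_le]
    constructor
    · linarith [neg_abs_le (cdf S (-s) - cdf P₀ (-s))]
    · linarith [abs_nonneg (cdf S (-s) - cdf P₀ (-s))]
  · intro t ht hts
    have ht' : -t ≤ 0 := by linarith
    have h1 := hR (Set.Ioi 0) Set.Ioi_subset_Ici_self measurableSet_Ioi
    rw [← one_sub_cdf, ← one_sub_cdf] at h1
    have h2 := hRn t ht hts
    rw [← cdf_sub_cdf R ht', ← cdf_sub_cdf P₀ ht'] at h2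
    have h3 := hup (-t) ht'
    have h4 : 0 ≤ κ * cdf P₀ (-t) := mul_nonneg hκ₀ (cdf_nonneg P₀ _)
    have h5 : κ * (L * t ^ 2) ≤ L * t ^ 2 := by
      have : 0 ≤ L * t ^ 2 := by positivity
      nlinarith
    have h6 : 0 ≤ L * t ^ 2 := by positivity
    rw [abs_le]
    constructor
    · linarith [le_abs_self (cdf R (-t) - cdf S (-t)), neg_abs_le (cdf R (-t) - cdf S (-t))]
    · linarith [abs_nonneg (cdf R (-t) - cdf S (-t))]
  · rw [setLIntegral_Icc_comp_neg fun t => ENNReal.ofReal ((cdf R t - cdf S t) ^ 2)]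
    exact (setLIntegral_le_lintegral _ _).trans hE

theorem lintegral_sq_cdf_sub_le (hκ₀ : 0 ≤ κ) (hκ₁ : κ ≤ 1) (hL : 0 ≤ L)
    (hs₀ : 0 < s₀) (hsa : s₀ ≤ a) (hw : 0 ≤ w)
    (hR : ∀ A ⊆ Set.Ici 0, MeasurableSet A → R.real A ≤ (1 + κ) * P₀.real A)
    (hS : ∀ A ⊆ Set.Iic 0, MeasurableSet A → S.real A ≤ (1 + κ) * P₀.real A)
    (hRn : ∀ t, 0 ≤ t → t ≤ s₀ →
      R.real (Set.Ioc (-t) 0) ≤ (1 + κ) * (P₀.real (Set.Ioc (-t) 0) + L * t ^ 2))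
    (hSn : ∀ t, 0 ≤ t → t ≤ s₀ →
      S.real (Set.Ioc 0 t) ≤ (1 + κ) * (P₀.real (Set.Ioc 0 t) + L * t ^ 2))
    (hE : ∫⁻ t, ENNReal.ofReal ((cdf R t - cdf S t) ^ 2) ≤ ENNReal.ofReal w) :
    ∫⁻ t in Set.Icc (-a) a, ENNReal.ofReal ((cdf R t - cdf P₀ t) ^ 2) ≤
      ENNReal.ofReal (2 * w + 3 * halfLineBound a s₀ κ (2 * L) w) := by
  have ha : 0 < a := hs₀.trans_le hsa
  have hB : 0 ≤ halfLineBound a s₀ κ (2 * L) w := by unfold halfLineBound; positivity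
  have mR : Measurable (cdf R) := (monotone_cdf R).measurable
  have mS : Measurable (cdf S) := (monotone_cdf S).measurable
  have hl : ∫⁻ t in Set.Icc (-a) 0, ENNReal.ofReal ((cdf R t - cdf P₀ t) ^ 2) ≤
      ENNReal.ofReal 2 * ENNReal.ofReal w +
        ENNReal.ofReal 2 * ENNReal.ofReal (halfLineBound a s₀ κ (2 * L) w) := by
    calc ∫⁻ t in Set.Icc (-a) 0, ENNReal.ofReal ((cdf R t - cdf P₀ t) ^ 2)
        ≤ ∫⁻ t in Set.Icc (-a) 0, (ENNReal.ofReal 2 * ENNReal.ofReal ((cdf R t - cdf S t) ^ 2) +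
            ENNReal.ofReal 2 * ENNReal.ofReal ((cdf S t - cdf P₀ t) ^ 2)) := by
          refine lintegral_mono fun t => ?_
          rw [← ENNReal.ofReal_mul (by norm_num), ← ENNReal.ofReal_mul (by norm_num),
            ← ENNReal.ofReal_add (by positivity) (by positivity)]
          apply ENNReal.ofReal_le_ofReal
          nlinarith [sq_nonneg ((cdf R t - cdf S t) - (cdf S t - cdf P₀ t))]
      _ = ENNReal.ofReal 2 * (∫⁻ t in Set.Icc (-a) 0, ENNReal.ofReal ((cdf R t - cdf S t) ^ 2)) +
            ENNReal.ofReal 2 *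
              ∫⁻ t in Set.Icc (-a) 0, ENNReal.ofReal ((cdf S t - cdf P₀ t) ^ 2) := by
          rw [lintegral_add_left (by fun_prop), lintegral_const_mul' _ _ ENNReal.ofReal_ne_top,
            lintegral_const_mul' _ _ ENNReal.ofReal_ne_top]
      _ ≤ _ := by
          gcongr
          · exact (setLIntegral_le_lintegral _ _).trans hE
          · exact lintegral_sq_cdf_sub_left_le hκ₀ hκ₁ hL hs₀ hsa hw hR hS hRn hE
  calc ∫⁻ t in Set.Icc (-a) a, ENNReal.ofReal ((cdf R t - cdf P₀ t) ^ 2)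
      ≤ ∫⁻ t in Set.Icc (-a) 0 ∪ Set.Icc 0 a, ENNReal.ofReal ((cdf R t - cdf P₀ t) ^ 2) :=
        lintegral_mono_set Set.Icc_subset_Icc_union_Icc
    _ ≤ (∫⁻ t in Set.Icc (-a) 0, ENNReal.ofReal ((cdf R t - cdf P₀ t) ^ 2)) +
          ∫⁻ t in Set.Icc 0 a, ENNReal.ofReal ((cdf R t - cdf P₀ t) ^ 2) :=
        lintegral_union_le _ _ _
    _ ≤ (ENNReal.ofReal 2 * ENNReal.ofReal w +
        ENNReal.ofReal 2 * ENNReal.ofReal (halfLineBound a s₀ κ (2 * L) w)) +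
          ENNReal.ofReal (halfLineBound a s₀ κ (2 * L) w) :=
        add_le_add hl (lintegral_sq_cdf_sub_right_le hκ₀ hκ₁ hL hs₀ hsa hw hR hS hSn hE)
    _ = _ := by
        rw [← ENNReal.ofReal_mul (by norm_num), ← ENNReal.ofReal_mul (by norm_num),
          ← ENNReal.ofReal_add (by positivity) (by positivity),
          ← ENNReal.ofReal_add (by positivity) (by positivity)]
        congr 1; ring

/-- Quantitative stability: a trimming `R` of `P` close to a trimming `S` of `Q` is close to the
common core `P₀`. -/
theorem W2_le_of_coupling {m M δ : ℝ} (hm : 0 < m) (hM : 0 < M)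
    (hleft : ∀ t < -a, cdf P₀ t = 0) (hright : cdf P₀ a = 1)
    (hdens : ∀ s t, -a ≤ s → s ≤ t → t ≤ a → m * (t - s) ≤ cdf P₀ t - cdf P₀ s)
    (hRa : R (Set.Ioi a) = 0) (hSa : S (Set.Iio (-a)) = 0)
    (hRM : ∀ s t, s ≤ t → R.real (Set.Ioc s t) ≤ M * (t - s))
    (hSM : ∀ s t, s ≤ t → S.real (Set.Ioc s t) ≤ M * (t - s))
    (hκ₀ : 0 ≤ κ) (hκ₁ : κ ≤ 1) (hL : 0 ≤ L) (hs₀ : 0 < s₀) (hsa : s₀ ≤ a) (hδ : 0 ≤ δ)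
    (hR : ∀ A ⊆ Set.Ici 0, MeasurableSet A → R.real A ≤ (1 + κ) * P₀.real A)
    (hS : ∀ A ⊆ Set.Iic 0, MeasurableSet A → S.real A ≤ (1 + κ) * P₀.real A)
    (hRn : ∀ t, 0 ≤ t → t ≤ s₀ →
      R.real (Set.Ioc (-t) 0) ≤ (1 + κ) * (P₀.real (Set.Ioc (-t) 0) + L * t ^ 2))
    (hSn : ∀ t, 0 ≤ t → t ≤ s₀ →
      S.real (Set.Ioc 0 t) ≤ (1 + κ) * (P₀.real (Set.Ioc 0 t) + L * t ^ 2))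
    (hW : W2 R S < ENNReal.ofReal δ) :
    W2 R P₀ ≤ ENNReal.ofReal (Real.sqrt (2 * δ ^ 2 + 4 / m * (2 * (4 * M * δ ^ 2) +
      3 * halfLineBound a s₀ κ (2 * L) (4 * M * δ ^ 2)))) := by
  have ha : 0 < a := hs₀.trans_le hsa
  -- Strictness of `hW` yields a coupling of cost below `δ ^ 2`, so no optimal coupling is needed.
  have hinf : ⨅ π ∈ couplings R S, ∫⁻ z, ENNReal.ofReal ((z.1 - z.2) ^ 2) ∂π <
      ENNReal.ofReal (δ ^ 2) := by
    have := ENNReal.rpow_lt_rpow hW (z := 2) (by norm_num)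
    rw [W2, ← ENNReal.rpow_mul, ENNReal.ofReal_rpow_of_nonneg hδ (by norm_num)] at this
    norm_num at this
    exact_mod_cast this
  simp only [iInf_lt_iff] at hinf
  obtain ⟨π, hπ, hcost⟩ := hinf
  set B := halfLineBound a s₀ κ (2 * L) (4 * M * δ ^ 2) with hBdef
  have hB : 0 ≤ B := by rw [hBdef]; unfold halfLineBound; positivity
  have hE : ∫⁻ t, ENNReal.ofReal ((cdf R t - cdf S t) ^ 2) ≤ ENNReal.ofReal (4 * M * δ ^ 2) := by
    refine (lintegral_sq_cdf_sub_le_of_coupling hM hRM hSM hπ).trans ?_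
    rw [ENNReal.ofReal_mul (p := 4 * M) (by positivity)]
    exact mul_le_mul_right hcost.le _
  have h1 := lintegral_sq_cdf_sub_le hκ₀ hκ₁ hL hs₀ hsa (by positivity) hR hS hRn hSn hE
  have h2 : ⨅ π ∈ couplings R P₀, ∫⁻ z, ENNReal.ofReal ((z.1 - z.2) ^ 2) ∂π ≤
      ENNReal.ofReal (2 * δ ^ 2 + 4 / m * (2 * (4 * M * δ ^ 2) + 3 * B)) := by
    refine (iInf_couplings_le_clamp ha hm hleft hright hdens hRa hSa hπ).trans ?_
    rw [ENNReal.ofReal_add (by positivity) (by positivity), ENNReal.ofReal_mul (by norm_num),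
      ENNReal.ofReal_mul (p := 4 / m) (by positivity)]
    exact add_le_add (mul_le_mul_right hcost.le _) (mul_le_mul_right h1 _)
  rw [W2, Real.sqrt_eq_rpow, ← ENNReal.ofReal_rpow_of_nonneg (by positivity) (by norm_num)]
  exact ENNReal.rpow_le_rpow h2 (by norm_num)

end Core

/-! ### Laws with densities, trimmings, and properties of `f`. -/

theorem lawOf_apply {g : ℝ → ℝ} (hg₀ : ∀ x, 0 ≤ g x) (hg : Integrable g) {A : Set ℝ}
    (hA : MeasurableSet A) : lawOf g A = ENNReal.ofReal (∫ x in A, g x) := by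
  rw [lawOf, withDensity_apply _ hA,
    ofReal_integral_eq_lintegral_ofReal hg.integrableOn (ae_of_all _ hg₀)]

theorem lawOf_real_apply {g : ℝ → ℝ} (hg₀ : ∀ x, 0 ≤ g x) (hg : Integrable g) {A : Set ℝ}
    (hA : MeasurableSet A) : (lawOf g).real A = ∫ x in A, g x := by
  rw [measureReal_def, lawOf_apply hg₀ hg hA,
    ENNReal.toReal_ofReal (integral_nonneg hg₀)]

theorem isProbabilityMeasure_lawOf {g : ℝ → ℝ} (hg₀ : ∀ x, 0 ≤ g x) (hg : Integrable g)
    (h1 : ∫ x, g x = 1) : IsProbabilityMeasure (lawOf g) :=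
  ⟨by rw [lawOf_apply hg₀ hg MeasurableSet.univ, setIntegral_univ, h1, ENNReal.ofReal_one]⟩

theorem real_le_of_mem_trimmings {β : ℝ} (hβ : β < 1) {P R : Measure ℝ} [IsProbabilityMeasure P]
    (hR : R ∈ trimmings β P) (A : Set ℝ) : R.real A ≤ 1 / (1 - β) * P.real A := by
  obtain ⟨hp, hac, hle⟩ := hR
  have hc : 0 ≤ 1 / (1 - β) := by
    have : 0 < 1 - β := by linarith
    positivity
  have h1 : R ≤ ENNReal.ofReal (1 / (1 - β)) • P := by
    rw [← Measure.withDensity_rnDeriv_eq R P hac, ← withDensity_const]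
    exact withDensity_mono hle
  have h2 := h1 A
  rw [Measure.smul_apply, smul_eq_mul] at h2
  have h3 := ENNReal.toReal_mono (ENNReal.mul_ne_top ENNReal.ofReal_ne_top (measure_ne_top P A)) h2
  rwa [ENNReal.toReal_mul, ENNReal.toReal_ofReal hc] at h3

namespace IsSymmUnimodalDensity

variable {f : ℝ → ℝ} {b : ℝ}

theorem apply_abs (hf : IsSymmUnimodalDensity f b) (x : ℝ) : f |x| = f x := by
  rcases abs_choice x with h | h <;> rw [h]
  exact hf.symm x

theorem le_of_abs_le_abs (hf : IsSymmUnimodalDensity f b) {x y : ℝ} (h : |x| ≤ |y|) :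
    f y ≤ f x := by
  rw [← hf.apply_abs x, ← hf.apply_abs y]
  exact hf.unimodal (abs_nonneg x) (abs_nonneg y) h

theorem nonneg (hf : IsSymmUnimodalDensity f b) (x : ℝ) : 0 ≤ f x := by
  by_cases hx : x ∈ Set.Icc (-b) b
  · exact (hf.pos x hx).le
  · exact (hf.zero_off x hx).ge

theorem apply_eq_zero (hf : IsSymmUnimodalDensity f b) {x : ℝ} (h : b < |x|) : f x = 0 :=
  hf.zero_off x fun hx => absurd (abs_le.2 hx) (not_le.2 h)

theorem le_apply_zero (hf : IsSymmUnimodalDensity f b) (x : ℝ) : f x ≤ f 0 :=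
  hf.le_of_abs_le_abs (by simp)

theorem apply_le_of_abs_le (hf : IsSymmUnimodalDensity f b) {x : ℝ} (h : |x| ≤ b) : f b ≤ f x :=
  hf.le_of_abs_le_abs (h.trans (le_abs_self b))

theorem apply_b_pos (hf : IsSymmUnimodalDensity f b) : 0 < f b :=
  hf.pos b ⟨by linarith [hf.b_pos], le_rfl⟩

theorem apply_zero_pos (hf : IsSymmUnimodalDensity f b) : 0 < f 0 :=
  hf.apply_b_pos.trans_le (hf.le_apply_zero b)

theorem integrable (hf : IsSymmUnimodalDensity f b) : Integrable f := by
  by_contra h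
  have := hf.integral_eq_one
  rw [integral_undef h] at this
  exact zero_ne_one this

theorem exists_lipschitz (hf : IsSymmUnimodalDensity f b) {h : ℝ} (h0 : 0 < h) (hb : h < b) :
    ∃ Λ δ : ℝ, 0 ≤ Λ ∧ 0 < δ ∧ ∀ x y, |x - h| < δ → |y - h| < δ → f x - f y ≤ Λ * |x - y| := by
  have hc : ContDiffAt ℝ 1 f h := hf.contDiffOn.contDiffAt (Ioo_mem_nhds h0 hb)
  obtain ⟨K, t, ht, hK⟩ := hc.exists_lipschitzOnWith
  obtain ⟨δ, hδ, hsub⟩ := Metric.mem_nhds_iff.1 ht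
  refine ⟨K, δ, K.2, hδ, fun x y hx hy => ?_⟩
  have h1 := hK.dist_le_mul x (hsub (by rwa [Metric.mem_ball, Real.dist_eq])) y
    (hsub (by rwa [Metric.mem_ball, Real.dist_eq]))
  rw [Real.dist_eq, Real.dist_eq] at h1
  exact (le_abs_self _).trans h1

theorem integrable_shift (hf : IsSymmUnimodalDensity f b) (c : ℝ) :
    Integrable fun x => f (x + c) := hf.integrable.comp_add_right c

theorem isProbabilityMeasure_shift (hf : IsSymmUnimodalDensity f b) (c : ℝ) :
    IsProbabilityMeasure (lawOf fun x => f (x + c)) :=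
  isProbabilityMeasure_lawOf (fun _ => hf.nonneg _) (hf.integrable_shift c)
    (by rw [integral_add_right_eq_self f c, hf.integral_eq_one])

theorem lawOf_shift_real (hf : IsSymmUnimodalDensity f b) (c : ℝ) {A : Set ℝ}
    (hA : MeasurableSet A) : (lawOf fun x => f (x + c)).real A = ∫ x in A, f (x + c) :=
  lawOf_real_apply (fun _ => hf.nonneg _) (hf.integrable_shift c) hA

theorem setIntegral_Ioi_shift (c : ℝ) : ∫ x in Set.Ioi 0, f (x + c) = ∫ x in Set.Ioi c, f x := by
  have := (measurePreserving_add_right (volume : Measure ℝ) c).setIntegral_preimage_emb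
    (measurableEmbedding_addRight c) f (Set.Ioi c)
  simpa using this

theorem setIntegral_Iic_shift (hf : IsSymmUnimodalDensity f b) (c : ℝ) :
    ∫ x in Set.Iic 0, f (x + -c) = ∫ x in Set.Ioi c, f x := by
  rw [← setIntegral_Ioi_shift, ← neg_zero, ← integral_comp_neg_Iic, neg_zero]
  congr 1 with x
  rw [← hf.symm]
  congr 1; ring

theorem setIntegral_Ioi_zero (hf : IsSymmUnimodalDensity f b) : ∫ x in Set.Ioi 0, f x = 1 / 2 := by
  have h1 := hf.setIntegral_Iic_shift 0
  have h2 := intervalIntegral.integral_Iic_add_Ioi (b := (0 : ℝ)) hf.integrable.integrableOn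
    hf.integrable.integrableOn
  simp only [neg_zero, add_zero] at h1
  rw [hf.integral_eq_one] at h2
  linarith

/-- The tail mass beyond `h` lies strictly between `0`, its value for `h ≥ b`, and `1 / 2`, its
value at `h = 0`. -/
theorem pos_and_lt_of_tail (hf : IsSymmUnimodalDensity f b) {α h : ℝ} (hα₀ : 0 < α) (hα₁ : α < 1)
    (hα : ∫ x in Set.Ioi h, f x = (1 - α) / 2) : 0 < h ∧ h < b := by
  constructor
  · by_contra! hh
    have h1 := hf.setIntegral_Ioi_zero
    have h2 : ∫ x in Set.Ioi 0, f x ≤ ∫ x in Set.Ioi h, f x :=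
      setIntegral_mono_set hf.integrable.integrableOn (ae_of_all _ hf.nonneg)
        (Set.Ioi_subset_Ioi hh).eventuallyLE
    linarith
  · by_contra! hh
    have h1 : ∫ x in Set.Ioi h, f x = 0 := by
      refine setIntegral_eq_zero_of_forall_eq_zero fun x hx => hf.apply_eq_zero ?_
      exact (hh.trans_lt hx).trans_le (le_abs_self x)
    linarith

end IsSymmUnimodalDensity

/-! ### The two shifted laws and their common core. -/

section Shifted

open IsSymmUnimodalDensity

variable {f : ℝ → ℝ} {b h α : ℝ}

theorem min_shift_of_nonneg (hf : IsSymmUnimodalDensity f b) (h0 : 0 < h) {x : ℝ} (hx : 0 ≤ x) :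
    min (f (x + h)) (f (x + -h)) = f (x + h) := by
  refine min_eq_left (hf.le_of_abs_le_abs ?_)
  rw [← sq_le_sq]; nlinarith

theorem min_shift_of_nonpos (hf : IsSymmUnimodalDensity f b) (h0 : 0 < h) {x : ℝ} (hx : x ≤ 0) :
    min (f (x + h)) (f (x + -h)) = f (x + -h) := by
  refine min_eq_right (hf.le_of_abs_le_abs ?_)
  rw [← sq_le_sq]; nlinarith

theorem core_nonneg (hf : IsSymmUnimodalDensity f b) (hα₁ : α < 1) (x : ℝ) :
    0 ≤ min (f (x + h)) (f (x + -h)) / (1 - α) :=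
  div_nonneg (le_min (hf.nonneg _) (hf.nonneg _)) (by linarith)

theorem integrable_core (hf : IsSymmUnimodalDensity f b) (h α : ℝ) :
    Integrable fun x => min (f (x + h)) (f (x + -h)) / (1 - α) :=
  ((hf.integrable_shift h).inf (hf.integrable_shift (-h))).div_const _

theorem core_real (hf : IsSymmUnimodalDensity f b) (hα₁ : α < 1) {A : Set ℝ}
    (hA : MeasurableSet A) :
    (commonCore α (fun x => f (x + h)) (fun x => f (x + -h))).real A =
      ∫ x in A, min (f (x + h)) (f (x + -h)) / (1 - α) :=
  lawOf_real_apply (core_nonneg hf hα₁) (integrable_core hf h α) hA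

theorem core_real_of_subset_Ici (hf : IsSymmUnimodalDensity f b) (h0 : 0 < h) (hα₁ : α < 1)
    {A : Set ℝ} (hA : MeasurableSet A) (hA0 : A ⊆ Set.Ici 0) :
    (commonCore α (fun x => f (x + h)) (fun x => f (x + -h))).real A =
      (∫ x in A, f (x + h)) / (1 - α) := by
  rw [core_real hf hα₁ hA, integral_div]
  congr 1
  exact setIntegral_congr_fun hA fun x hx => min_shift_of_nonneg hf h0 (hA0 hx)

theorem core_real_of_subset_Iic (hf : IsSymmUnimodalDensity f b) (h0 : 0 < h) (hα₁ : α < 1)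
    {A : Set ℝ} (hA : MeasurableSet A) (hA0 : A ⊆ Set.Iic 0) :
    (commonCore α (fun x => f (x + h)) (fun x => f (x + -h))).real A =
      (∫ x in A, f (x + -h)) / (1 - α) := by
  rw [core_real hf hα₁ hA, integral_div]
  congr 1
  exact setIntegral_congr_fun hA fun x hx => min_shift_of_nonpos hf h0 (hA0 hx)

/-- Each half-line contributes one tail of `f` beyond `h`, of mass `(1 - α) / 2`. -/
theorem integral_core (hf : IsSymmUnimodalDensity f b) (h0 : 0 < h) (hα₁ : α < 1)
    (hα : ∫ x in Set.Ioi h, f x = (1 - α) / 2) :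
    ∫ x, min (f (x + h)) (f (x + -h)) / (1 - α) = 1 := by
  have hi := integrable_core hf h α
  have h1 := core_real_of_subset_Iic hf h0 hα₁ measurableSet_Iic le_rfl
  have h2 := core_real_of_subset_Ici hf h0 hα₁ measurableSet_Ioi Set.Ioi_subset_Ici_self
  rw [core_real hf hα₁ measurableSet_Iic, hf.setIntegral_Iic_shift, hα] at h1
  rw [core_real hf hα₁ measurableSet_Ioi, setIntegral_Ioi_shift, hα] at h2
  rw [← intervalIntegral.integral_Iic_add_Ioi (b := (0 : ℝ)) hi.integrableOn hi.integrableOn,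
    h1, h2]
  have : 1 - α ≠ 0 := by linarith
  field_simp
  norm_num

theorem isProbabilityMeasure_core (hf : IsSymmUnimodalDensity f b) (h0 : 0 < h) (hα₁ : α < 1)
    (hα : ∫ x in Set.Ioi h, f x = (1 - α) / 2) :
    IsProbabilityMeasure (commonCore α (fun x => f (x + h)) (fun x => f (x + -h))) :=
  isProbabilityMeasure_lawOf (core_nonneg hf hα₁) (integrable_core hf h α)
    (integral_core hf h0 hα₁ hα)

theorem core_density_le (hf : IsSymmUnimodalDensity f b) (hα₁ : α < 1) {c : ℝ}
    (hc : ∀ x, min (f (x + h)) (f (x + -h)) ≤ f (x + c)) {A : Set ℝ} (hA : MeasurableSet A) :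
    (1 - α) * (commonCore α (fun x => f (x + h)) (fun x => f (x + -h))).real A ≤
      (lawOf fun x => f (x + c)).real A := by
  have hα' : 0 < 1 - α := by linarith
  rw [core_real hf hα₁ hA, hf.lawOf_shift_real c hA, integral_div, mul_div_cancel₀ _ hα'.ne']
  exact setIntegral_mono ((hf.integrable_shift h).inf (hf.integrable_shift (-h))).integrableOn
    (hf.integrable_shift c).integrableOn hc

/-- Both laws dominate `(1 - α) P₀`, on `B` and on its complement, which bounds the difference by
`α`; the half-line `(-∞, 0]` attains it. -/
theorem tvDist_shift (hf : IsSymmUnimodalDensity f b) (h0 : 0 < h) (hα₁ : α < 1)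
    (hα : ∫ x in Set.Ioi h, f x = (1 - α) / 2) :
    tvDist (lawOf fun x => f (x + h)) (lawOf fun x => f (x + -h)) = α := by
  have := hf.isProbabilityMeasure_shift h
  have := hf.isProbabilityMeasure_shift (-h)
  have := isProbabilityMeasure_core hf h0 hα₁ hα
  set P := lawOf fun x => f (x + h) with hP
  set Q := lawOf fun x => f (x + -h) with hQ
  set P₀ := commonCore α (fun x => f (x + h)) (fun x => f (x + -h))
  have hle : ∀ B : {B : Set ℝ // MeasurableSet B}, |P.real B - Q.real B| ≤ α := by
    rintro ⟨B, hB⟩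
    have p1 : (1 - α) * P₀.real B ≤ P.real B :=
      core_density_le hf hα₁ (fun x => min_le_left _ _) hB
    have q1 : (1 - α) * P₀.real B ≤ Q.real B :=
      core_density_le hf hα₁ (fun x => min_le_right _ _) hB
    have p2 : (1 - α) * P₀.real Bᶜ ≤ P.real Bᶜ :=
      core_density_le hf hα₁ (fun x => min_le_left _ _) hB.compl
    have q2 : (1 - α) * P₀.real Bᶜ ≤ Q.real Bᶜ :=
      core_density_le hf hα₁ (fun x => min_le_right _ _) hB.compl
    rw [probReal_compl_eq_one_sub hB, probReal_compl_eq_one_sub hB] at p2 q2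
    rw [abs_le]
    constructor <;> simp only <;> linarith
  apply le_antisymm
  · have : Nonempty {B : Set ℝ // MeasurableSet B} := ⟨⟨∅, MeasurableSet.empty⟩⟩
    exact ciSup_le hle
  · have h1 : P.real (Set.Iic 0) = 1 - (1 - α) / 2 := by
      have : P.real (Set.Ioi 0) = (1 - α) / 2 := by
        rw [hP, hf.lawOf_shift_real h measurableSet_Ioi, setIntegral_Ioi_shift, hα]
      rw [← this, ← Set.compl_Iic, probReal_compl_eq_one_sub measurableSet_Iic]
      ring
    have h2 : Q.real (Set.Iic 0) = (1 - α) / 2 := by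
      rw [hQ, hf.lawOf_shift_real (-h) measurableSet_Iic, hf.setIntegral_Iic_shift, hα]
    have h3 := le_ciSup (f := fun B : {B : Set ℝ // MeasurableSet B} => |P.real B - Q.real B|)
      ⟨α, by rintro _ ⟨B, rfl⟩; exact hle B⟩ ⟨Set.Iic 0, measurableSet_Iic⟩
    refine le_trans ?_ h3
    simp only [h1, h2]
    refine le_trans (le_of_eq ?_) (le_abs_self _)
    ring

theorem cdf_core_eq_zero (hf : IsSymmUnimodalDensity f b) (h0 : 0 < h) (hb : h < b) (hα₁ : α < 1)
    (hα : ∫ x in Set.Ioi h, f x = (1 - α) / 2) {t : ℝ} (ht : t < -(b - h)) :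
    cdf (commonCore α (fun x => f (x + h)) (fun x => f (x + -h))) t = 0 := by
  have := isProbabilityMeasure_core hf h0 hα₁ hα
  rw [cdf_eq_real, core_real_of_subset_Iic hf h0 hα₁ measurableSet_Iic
    (Set.Iic_subset_Iic.2 (by linarith)), setIntegral_eq_zero_of_forall_eq_zero, zero_div]
  intro x hx
  refine hf.apply_eq_zero (lt_of_lt_of_le ?_ (neg_le_abs _))
  have : x ≤ t := hx
  linarith

theorem cdf_core_eq_one (hf : IsSymmUnimodalDensity f b) (h0 : 0 < h) (hb : h < b) (hα₁ : α < 1)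
    (hα : ∫ x in Set.Ioi h, f x = (1 - α) / 2) :
    cdf (commonCore α (fun x => f (x + h)) (fun x => f (x + -h))) (b - h) = 1 := by
  have := isProbabilityMeasure_core hf h0 hα₁ hα
  suffices hz : 1 - cdf (commonCore α (fun x => f (x + h)) (fun x => f (x + -h))) (b - h) = 0 by
    linarith
  rw [one_sub_cdf, core_real_of_subset_Ici hf h0 hα₁ measurableSet_Ioi
    (fun x hx => (sub_pos.2 hb).le.trans (le_of_lt hx)), setIntegral_eq_zero_of_forall_eq_zero,
    zero_div]
  intro x hx
  refine hf.apply_eq_zero (lt_of_lt_of_le ?_ (le_abs_self _))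
  have : b - h < x := hx
  linarith

/-- For `|x| ≤ b - h` both `x + h` and `x - h` lie in `[-b, b]`, where `f ≥ f b > 0`. -/
theorem le_cdf_core_sub (hf : IsSymmUnimodalDensity f b) (h0 : 0 < h) (hα₁ : α < 1)
    (hα : ∫ x in Set.Ioi h, f x = (1 - α) / 2) {s t : ℝ} (hs : -(b - h) ≤ s) (hst : s ≤ t)
    (ht : t ≤ b - h) :
    f b / (1 - α) * (t - s) ≤
      cdf (commonCore α (fun x => f (x + h)) (fun x => f (x + -h))) t -
        cdf (commonCore α (fun x => f (x + h)) (fun x => f (x + -h))) s := by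
  have := isProbabilityMeasure_core hf h0 hα₁ hα
  have hα' : 0 < 1 - α := by linarith
  rw [cdf_sub_cdf _ hst, core_real hf hα₁ measurableSet_Ioc]
  have h1 : ∫ _ in Set.Ioc s t, f b / (1 - α) = f b / (1 - α) * (t - s) := by
    rw [setIntegral_const, Real.volume_real_Ioc_of_le hst, smul_eq_mul, mul_comm]
  rw [← h1]
  refine setIntegral_mono_on (integrableOn_const (by simp)) (integrable_core hf h α).integrableOn
    measurableSet_Ioc fun x hx => ?_
  gcongr
  exact le_min (hf.apply_le_of_abs_le (abs_le.2 ⟨by linarith [hx.1], by linarith [hx.2]⟩))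
    (hf.apply_le_of_abs_le (abs_le.2 ⟨by linarith [hx.1], by linarith [hx.2]⟩))

theorem lawOf_shift_real_Ioc_le (hf : IsSymmUnimodalDensity f b) (c : ℝ) {s t : ℝ} (hst : s ≤ t) :
    (lawOf fun x => f (x + c)).real (Set.Ioc s t) ≤ f 0 * (t - s) := by
  rw [hf.lawOf_shift_real c measurableSet_Ioc]
  have h1 : ∫ _ in Set.Ioc s t, f 0 = f 0 * (t - s) := by
    rw [setIntegral_const, Real.volume_real_Ioc_of_le hst, smul_eq_mul, mul_comm]
  rw [← h1]
  exact setIntegral_mono (hf.integrable_shift c).integrableOn (integrableOn_const (by simp))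
    fun x => hf.le_apply_zero _

theorem setIntegral_shift_le {g₁ g₂ : ℝ → ℝ} (h₁ : Integrable g₁) (h₂ : Integrable g₂)
    {s t c : ℝ} (hst : s ≤ t) (hc : ∀ x ∈ Set.Ioc s t, g₁ x - g₂ x ≤ c) :
    ∫ x in Set.Ioc s t, g₁ x ≤ (∫ x in Set.Ioc s t, g₂ x) + c * (t - s) := by
  have h1 : ∫ _ in Set.Ioc s t, c = c * (t - s) := by
    rw [setIntegral_const, Real.volume_real_Ioc_of_le hst, smul_eq_mul, mul_comm]
  rw [← h1, ← integral_add h₂.integrableOn (integrableOn_const (by simp))]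
  refine setIntegral_mono_on h₁.integrableOn
    (h₂.integrableOn.add (integrableOn_const (by simp))) measurableSet_Ioc fun x hx => ?_
  linarith [hc x hx]

end Shifted

/-! ### Choice of scales and the rate. -/

/-- All scales are powers of `r = n^(-1/10)`: `s₀ = r²`, `κ = A r⁵`, `w = W r¹⁰`. The near-zero
integral is then `O(r¹⁰)`, and dividing it by `s₀` gives the dominant order `r⁸`. -/
theorem halfLineBound_le {a C A W r : ℝ} (ha : 0 ≤ a) (hW : 0 ≤ W) (hr₀ : 0 < r) (hr₁ : r ≤ 1) :
    halfLineBound a (r ^ 2) (A * r ^ 5) C (W * r ^ 10) ≤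
      ((3 * W + 3 * A ^ 2 + 3 * C ^ 2) * (1 + 2 * a) + 2 * a * A ^ 2) * r ^ 8 := by
  have h10 : r ^ 10 ≤ r ^ 8 := pow_le_pow_of_le_one hr₀.le hr₁ (by norm_num)
  have h12 : r ^ 12 ≤ r ^ 10 := pow_le_pow_of_le_one hr₀.le hr₁ (by norm_num)
  set J := 3 * (W * r ^ 10) + 3 * (A * r ^ 5) ^ 2 * r ^ 2 + 3 * C ^ 2 * (r ^ 2) ^ 5 with hJ
  have hJle : J ≤ (3 * W + 3 * A ^ 2 + 3 * C ^ 2) * r ^ 10 := by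
    have : J = (3 * W + 3 * C ^ 2) * r ^ 10 + 3 * A ^ 2 * r ^ 12 := by rw [hJ]; ring
    rw [this]
    nlinarith [mul_le_mul_of_nonneg_left h12 (sq_nonneg A)]
  have hdiv : 2 * J / r ^ 2 ≤ 2 * (3 * W + 3 * A ^ 2 + 3 * C ^ 2) * r ^ 8 := by
    rw [div_le_iff₀ (by positivity)]
    calc 2 * J ≤ 2 * ((3 * W + 3 * A ^ 2 + 3 * C ^ 2) * r ^ 10) := by linarith
      _ = _ := by ring
  have hc : 0 ≤ 3 * W + 3 * A ^ 2 + 3 * C ^ 2 := by positivity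
  have hA : 2 * (A * r ^ 5) ^ 2 ≤ 2 * A ^ 2 * r ^ 8 := by
    nlinarith [mul_le_mul_of_nonneg_left h10 (sq_nonneg A)]
  calc halfLineBound a (r ^ 2) (A * r ^ 5) C (W * r ^ 10)
      = J + a * (2 * J / r ^ 2 + 2 * (A * r ^ 5) ^ 2) := rfl
    _ ≤ (3 * W + 3 * A ^ 2 + 3 * C ^ 2) * r ^ 8 +
        a * (2 * (3 * W + 3 * A ^ 2 + 3 * C ^ 2) * r ^ 8 + 2 * A ^ 2 * r ^ 8) := by
      gcongr
      exact hJle.trans (by gcongr)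
    _ = _ := by ring

section Rate

variable {f : ℝ → ℝ} {b h α : ℝ}

theorem exists_W2_core_le (hf : IsSymmUnimodalDensity f b) (h0 : 0 < h) (hb : h < b)
    (hα₁ : α < 1) (hα : ∫ x in Set.Ioi h, f x = (1 - α) / 2) :
    ∃ m M L σ : ℝ, 0 < m ∧ 0 < M ∧ 0 < σ ∧ ∀ η δ s₀ : ℝ, 0 ≤ η → η ≤ (1 - α) / 2 → 0 ≤ δ →
      0 < s₀ → s₀ ≤ σ → ∀ R ∈ trimmings (α + η) (lawOf fun x => f (x + h)),
      ∀ S ∈ trimmings (α + η) (lawOf fun x => f (x + -h)), W2 R S < ENNReal.ofReal δ →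
      W2 R (commonCore α (fun x => f (x + h)) (fun x => f (x + -h))) ≤
        ENNReal.ofReal (Real.sqrt (2 * δ ^ 2 + 4 / m * (2 * (4 * M * δ ^ 2) +
          3 * halfLineBound (b - h) s₀ (2 / (1 - α) * η) (2 * L) (4 * M * δ ^ 2)))) := by
  have hα' : 0 < 1 - α := by linarith
  obtain ⟨Λ, σ, hΛ, hσ, hlip⟩ := hf.exists_lipschitz h0 hb
  refine ⟨f b / (1 - α), 2 / (1 - α) * f 0, 2 * Λ / (1 - α), min (b - h) (σ / 2),
    div_pos hf.apply_b_pos hα', mul_pos (by positivity) hf.apply_zero_pos,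
    lt_min (by linarith) (by linarith), ?_⟩
  intro η δ s₀ hη₀ hη₁ hδ hs₀ hsσ R hR S hS hW
  have := hf.isProbabilityMeasure_shift h
  have := hf.isProbabilityMeasure_shift (-h)
  have := isProbabilityMeasure_core hf h0 hα₁ hα
  have : IsProbabilityMeasure R := hR.1
  have : IsProbabilityMeasure S := hS.1
  have hsa : s₀ ≤ b - h := hsσ.trans (min_le_left _ _)
  have hsσ' : s₀ < σ := (hsσ.trans (min_le_right _ _)).trans_lt (by linarith)
  have hβ : α + η < 1 := by linarith
  have hκ₀ : 0 ≤ 2 / (1 - α) * η := by positivity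
  have hκ₁ : 2 / (1 - α) * η ≤ 1 := by
    rw [div_mul_eq_mul_div, div_le_one hα']; linarith
  set κ := 2 / (1 - α) * η with hκ
  -- Cross-multiplied, this reduces to `κ * η ≤ η`, which follows from `κ ≤ 1`; hence the factor 2
  -- in `κ` and the restriction `η ≤ (1 - α) / 2`.
  have hlev : 1 / (1 - (α + η)) ≤ (1 + κ) / (1 - α) := by
    rw [div_le_div_iff₀ (by linarith) hα']
    have h1 : κ * (1 - α) = 2 * η := by rw [hκ]; field_simp
    have h2 : κ * η ≤ η := by nlinarith
    nlinarith
  have hlev' : (1 + κ) / (1 - α) ≤ 2 / (1 - α) := by gcongr; linarith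
  have hRle : ∀ A, R.real A ≤ (1 + κ) / (1 - α) * (lawOf fun x => f (x + h)).real A := fun A =>
    (real_le_of_mem_trimmings hβ hR A).trans (mul_le_mul_of_nonneg_right hlev measureReal_nonneg)
  have hSle : ∀ A, S.real A ≤ (1 + κ) / (1 - α) * (lawOf fun x => f (x + -h)).real A := fun A =>
    (real_le_of_mem_trimmings hβ hS A).trans (mul_le_mul_of_nonneg_right hlev measureReal_nonneg)
  have hnear : ∀ t, 0 ≤ t → t ≤ s₀ → ∀ x, -t ≤ x → x ≤ 0 →
      f (x + h) - f (x + -h) ≤ 2 * Λ * t := by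
    intro t ht hts x hx hx0
    -- By symmetry `f (x - h) = f (h - x)`, so both arguments lie near `h`, at distance `2|x|` from
    -- each other.
    have h1 := hlip (x + h) (-(x + -h)) (by rw [abs_lt]; constructor <;> linarith)
      (by rw [abs_lt]; constructor <;> linarith)
    rw [hf.symm] at h1
    refine h1.trans ?_
    rw [show 2 * Λ * t = Λ * (2 * t) by ring]
    refine mul_le_mul_of_nonneg_left ?_ hΛ
    rw [abs_le]; constructor <;> linarith
  refine W2_le_of_coupling (a := b - h) (div_pos hf.apply_b_pos hα')
    (mul_pos (by positivity) hf.apply_zero_pos)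
    (fun t ht => cdf_core_eq_zero hf h0 hb hα₁ hα ht) (cdf_core_eq_one hf h0 hb hα₁ hα)
    (fun s t hs hst ht => le_cdf_core_sub hf h0 hα₁ hα hs hst ht) (hR.2.1 ?_) (hS.2.1 ?_)
    ?_ ?_ hκ₀ hκ₁ (by positivity) hs₀ hsa hδ ?_ ?_ ?_ ?_ hW
  · rw [lawOf_apply (fun _ => hf.nonneg _) (hf.integrable_shift h) measurableSet_Ioi,
      setIntegral_eq_zero_of_forall_eq_zero, ENNReal.ofReal_zero]
    intro x hx
    have : b - h < x := hx
    exact hf.apply_eq_zero (lt_of_lt_of_le (by linarith) (le_abs_self _))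
  · rw [lawOf_apply (fun _ => hf.nonneg _) (hf.integrable_shift (-h)) measurableSet_Iio,
      setIntegral_eq_zero_of_forall_eq_zero, ENNReal.ofReal_zero]
    intro x hx
    have : x < -(b - h) := hx
    exact hf.apply_eq_zero (lt_of_lt_of_le (by linarith) (neg_le_abs _))
  · intro s t hst
    rw [mul_assoc]
    exact (hRle _).trans (mul_le_mul hlev' (lawOf_shift_real_Ioc_le hf h hst) measureReal_nonneg
      (by positivity))
  · intro s t hst
    rw [mul_assoc]
    exact (hSle _).trans (mul_le_mul hlev' (lawOf_shift_real_Ioc_le hf (-h) hst) measureReal_nonneg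
      (by positivity))
  · intro A hA0 hA
    rw [core_real_of_subset_Ici hf h0 hα₁ hA hA0, ← hf.lawOf_shift_real h hA,
      ← mul_div_assoc, mul_div_right_comm]
    exact hRle A
  · intro A hA0 hA
    rw [core_real_of_subset_Iic hf h0 hα₁ hA hA0, ← hf.lawOf_shift_real (-h) hA,
      ← mul_div_assoc, mul_div_right_comm]
    exact hSle A
  · intro t ht hts
    rw [core_real_of_subset_Iic hf h0 hα₁ measurableSet_Ioc fun x hx => hx.2]
    refine (hRle _).trans ?_
    rw [hf.lawOf_shift_real h measurableSet_Ioc]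
    have h1 := setIntegral_shift_le (hf.integrable_shift h) (hf.integrable_shift (-h))
      (neg_nonpos.2 ht) fun x hx => hnear t ht hts x hx.1.le hx.2
    calc _ ≤ (1 + κ) / (1 - α) * ((∫ x in Set.Ioc (-t) 0, f (x + -h)) + 2 * Λ * t * (0 - -t)) :=
          mul_le_mul_of_nonneg_left h1 (by positivity)
      _ = _ := by field_simp; ring
  · intro t ht hts
    rw [core_real_of_subset_Ici hf h0 hα₁ measurableSet_Ioc fun x hx => hx.1.le]
    refine (hSle _).trans ?_
    rw [hf.lawOf_shift_real (-h) measurableSet_Ioc]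
    have h1 := setIntegral_shift_le (c := 2 * Λ * t) (hf.integrable_shift (-h))
      (hf.integrable_shift h) ht fun x hx => by
        have := hnear t ht hts (-x) (neg_le_neg hx.2) (neg_nonpos.2 hx.1.le)
        rwa [← hf.symm (-x + h), ← hf.symm (-x + -h), show -(-x + h) = x + -h by ring,
          show -(-x + -h) = x + h by ring] at this
    calc _ ≤ (1 + κ) / (1 - α) * ((∫ x in Set.Ioc 0 t, f (x + h)) + 2 * Λ * t * (t - 0)) :=
          mul_le_mul_of_nonneg_left h1 (by positivity)
      _ = _ := by field_simp; ring

theorem isBigORate_W2_core (hf : IsSymmUnimodalDensity f b) (h0 : 0 < h) (hb : h < b)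
    (hα₁ : α < 1) (hα : ∫ x in Set.Ioi h, f x = (1 - α) / 2)
    {K : ℝ} (hK : 0 < K) {Pt Qt : ℕ → Measure ℝ}
    (htrim : ∀ᶠ n : ℕ in atTop,
      Pt n ∈ trimmings (α + K / Real.sqrt n) (lawOf fun x => f (x + h)) ∧
      Qt n ∈ trimmings (α + K / Real.sqrt n) (lawOf fun x => f (x + -h)))
    (hW : IsBigORate (fun n => W2 (Pt n) (Qt n)) (1 / 2)) :
    IsBigORate (fun n => W2 (Pt n) (commonCore α (fun x => f (x + h)) (fun x => f (x + -h))))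
      (2 / 5) := by
  have hα' : 0 < 1 - α := by linarith
  obtain ⟨m, M, L, σ, hm, hM, hσ, hmain⟩ := exists_W2_core_le hf h0 hb hα₁ hα
  obtain ⟨C, hC⟩ := hW
  -- The added `1` makes the bound on `W2` strict.
  set c : ℝ := C + 1 with hc
  have hc0 : (0 : ℝ) < c := by positivity
  set A : ℝ := 2 / (1 - α) * K
  set H : ℝ := (3 * (4 * M * c ^ 2) + 3 * A ^ 2 + 3 * (2 * L) ^ 2) * (1 + 2 * (b - h)) +
    2 * (b - h) * A ^ 2
  set Z : ℝ := 2 * c ^ 2 + 4 / m * (2 * (4 * M * c ^ 2) + 3 * H) with hZ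
  have hbh : 0 < b - h := by linarith
  have hr : Tendsto (fun n : ℕ => (n : ℝ) ^ (-(1 / 10) : ℝ)) atTop (nhds 0) :=
    (tendsto_rpow_neg_atTop (by norm_num)).comp tendsto_natCast_atTop_atTop
  have hev : ∀ k : ℕ, k ≠ 0 → ∀ y : ℝ, 0 < y →
      ∀ᶠ n : ℕ in atTop, ((n : ℝ) ^ (-(1 / 10) : ℝ)) ^ k ≤ y := by
    intro k hk y hy
    have := hr.pow k
    rw [zero_pow hk] at this
    exact this.eventually (ge_mem_nhds hy)
  refine ⟨(Real.sqrt Z).toNNReal, ?_⟩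
  filter_upwards [htrim, hC, eventually_ge_atTop 1, hev 2 (by norm_num) σ hσ,
    hev 5 (by norm_num) ((1 - α) / 2 / K) (by positivity)] with n hn hCn hn1 hnσ hnη
  have hn0 : (0 : ℝ) < n := by exact_mod_cast hn1
  set r : ℝ := (n : ℝ) ^ (-(1 / 10) : ℝ) with hrdef
  have hr0 : 0 < r := Real.rpow_pos_of_pos hn0 _
  have hr1 : r ≤ 1 := Real.rpow_le_one_of_one_le_of_nonpos (by exact_mod_cast hn1) (by norm_num)
  have hr5 : (n : ℝ) ^ (-(1 / 2) : ℝ) = r ^ 5 := by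
    rw [hrdef, ← Real.rpow_natCast, ← Real.rpow_mul hn0.le]; norm_num
  have hr4 : (n : ℝ) ^ (-(2 / 5) : ℝ) = r ^ 4 := by
    rw [hrdef, ← Real.rpow_natCast, ← Real.rpow_mul hn0.le]; norm_num
  have hη : K / Real.sqrt n = K * r ^ 5 := by
    rw [← hr5, Real.rpow_neg hn0.le, ← Real.sqrt_eq_rpow]; rfl
  rw [hη] at hn
  rw [hr5] at hCn
  have hlt : W2 (Pt n) (Qt n) < ENNReal.ofReal (c * r ^ 5) := by
    refine hCn.trans_lt ?_
    rw [← ENNReal.ofReal_coe_nnreal, ← ENNReal.ofReal_mul C.coe_nonneg,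
      ENNReal.ofReal_lt_ofReal_iff (by positivity)]
    have : 0 < r ^ 5 := by positivity
    simp only [hc]
    nlinarith
  rw [le_div_iff₀ hK, mul_comm] at hnη
  have key := hmain (K * r ^ 5) (c * r ^ 5) (r ^ 2) (by positivity) hnη (by positivity)
    (by positivity) hnσ (Pt n) hn.1 (Qt n) hn.2 hlt
  refine key.trans ?_
  rw [hr4, ENNReal.ofNNReal_toNNReal, ← ENNReal.ofReal_mul (Real.sqrt_nonneg _)]
  apply ENNReal.ofReal_le_ofReal
  rw [← Real.sqrt_sq (by positivity : (0 : ℝ) ≤ r ^ 4), ← Real.sqrt_mul' _ (by positivity)]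
  apply Real.sqrt_le_sqrt
  have hB := halfLineBound_le (a := b - h) (C := 2 * L) (A := A) (W := 4 * M * c ^ 2) hbh.le
    (by positivity) hr0 hr1
  have h10 : r ^ 10 ≤ r ^ 8 := pow_le_pow_of_le_one hr0.le hr1 (by norm_num)
  have e1 : 2 / (1 - α) * (K * r ^ 5) = A * r ^ 5 := by ring
  have e2 : 4 * M * (c * r ^ 5) ^ 2 = 4 * M * c ^ 2 * r ^ 10 := by ring
  rw [e1, e2]
  calc 2 * (c * r ^ 5) ^ 2 + 4 / m * (2 * (4 * M * c ^ 2 * r ^ 10) + 3 *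
        halfLineBound (b - h) (r ^ 2) (A * r ^ 5) (2 * L) (4 * M * c ^ 2 * r ^ 10))
      = 2 * c ^ 2 * r ^ 10 + 4 / m * (2 * (4 * M * c ^ 2) * r ^ 10 + 3 *
        halfLineBound (b - h) (r ^ 2) (A * r ^ 5) (2 * L) (4 * M * c ^ 2 * r ^ 10)) := by ring
    _ ≤ 2 * c ^ 2 * r ^ 8 + 4 / m * (2 * (4 * M * c ^ 2) * r ^ 8 + 3 * (H * r ^ 8)) := by
        gcongr
    _ = Z * (r ^ 4) ^ 2 := by rw [hZ]; ring

end Rate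

theorem mainTheorem8 (f : ℝ → ℝ) (b : ℝ) (hf : IsSymmUnimodalDensity f b)
    (α μ : ℝ) (hα₀ : 0 < α) (hα₁ : α < 1)
    (hα : 1 - α = 2 * (1 - cdf (lawOf f) (μ / 2)))
    (P Q P₀ : Measure ℝ)
    (hP : P = lawOf fun x => f (x + μ / 2))
    (hQ : Q = lawOf fun x => f (x - μ / 2))
    (hP₀ : P₀ = commonCore α (fun x => f (x + μ / 2)) (fun x => f (x - μ / 2))) :
    tvDist P Q = α ∧
    (∀ K : ℝ, 0 < K → ∀ Pt Qt : ℕ → Measure ℝ,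
      (∀ᶠ n : ℕ in atTop, Pt n ∈ trimmings (α + K / Real.sqrt n) P ∧
        Qt n ∈ trimmings (α + K / Real.sqrt n) Q) →
      IsBigORate (fun n => W2 (Pt n) (Qt n)) (1 / 2) →
      IsBigORate (fun n => W2 (Pt n) P₀) (2 / 5)) ∧
    RateCondition P Q P₀ (4 / 5) := by
  -- Both laws become shifts `x + c` with `c = ± μ / 2`, the form used in the lemmas.
  simp only [sub_eq_add_neg _ (μ / 2)] at hQ hP₀
  have htail : ∫ x in Set.Ioi (μ / 2), f x = (1 - α) / 2 := by
    have : IsProbabilityMeasure (lawOf f) :=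
      isProbabilityMeasure_lawOf hf.nonneg hf.integrable hf.integral_eq_one
    rw [one_sub_cdf, lawOf_real_apply hf.nonneg hf.integrable measurableSet_Ioi] at hα
    linarith
  obtain ⟨h0, hb⟩ := hf.pos_and_lt_of_tail hα₀ hα₁ htail
  have htv : tvDist P Q = α := by rw [hP, hQ]; exact tvDist_shift hf h0 hα₁ htail
  have hrate : ∀ K : ℝ, 0 < K → ∀ Pt Qt : ℕ → Measure ℝ,
      (∀ᶠ n : ℕ in atTop, Pt n ∈ trimmings (α + K / Real.sqrt n) P ∧
        Qt n ∈ trimmings (α + K / Real.sqrt n) Q) →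
      IsBigORate (fun n => W2 (Pt n) (Qt n)) (1 / 2) →
      IsBigORate (fun n => W2 (Pt n) P₀) (2 / 5) := by
    intro K hK Pt Qt htrim hW
    rw [hP, hQ] at htrim
    rw [hP₀]
    exact isBigORate_W2_core hf h0 hb hα₁ htail hK htrim hW
  refine ⟨htv, hrate, by norm_num, by norm_num, ?_⟩
  rw [htv, show (4 / 5 / 2 : ℝ) = 2 / 5 by norm_num]
  exact hrate
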